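/- All groups are profinite, homomorphisms are continuous, subgroups are closed, and $\twoheadrightarrow$ denotes an epimorphism. For epimorphisms $\tau\colon H\twoheadrightarrow G$ and $\tau'\colon H'\twoheadrightarrow G$, write $\tau'\preccurlyeq\tau$ ($\tau'$ is dominated by $\tau$) if $\tau=\tau'\circ\psi$ for some epimorphism $\psi\colon H\twoheadrightarrow H'$, and $\tau'\cong_G\tau$ if $\tau=\tau'\circ\psi$ for some isomorphism $\psi\colon H\to H'$. The epimorphism $\tau$ is *fundamental* if $\operatorname{Ker}\tau=1$ or the intersection of all maximal elements of the set of normal subgroups of $H$ strictly contained in $\operatorname{Ker}\tau$ is trivial. An epimorphism $\varphi\colon H\twoheadrightarrow G$ is *indecomposable* if it is not an isomorphism and, whenever $\varphi=\rho\circ\psi$ with epimorphisms $\psi\colon H\twoheadrightarrow E$ and $\rho\colon E\twoheadrightarrow G$, one of $\psi,\rho$ is an isomorphism. Let $\Lambda_{\mathrm{na}}(G)$ be a set of representatives of the isomorphism classes (with respect to $\cong_G$) of indecomposable epimorphisms onto $G$ with non-abelian kernel, let $\Lambda_{\mathrm{ab}}(G)$ be the set of isomorphism classes of finite simple $G$-modules,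 and let $\Lambda(G)=\Lambda_{\mathrm{ab}}(G)\,\dot\cup\,\Lambda_{\mathrm{na}}(G)$. Let $\tau\colon H\twoheadrightarrow G$ be an epimorphism. * For $\zeta\in\Lambda_{\mathrm{na}}(G)$, $\operatorname{mult}_\zeta(\tau)$ is the cardinality of the set of normal subgroups $N$ of $H$ with $N\le\operatorname{Ker}\tau$ such that the induced map $H/N\twoheadrightarrow G$ is isomorphic to $\zeta$ over $G$. * For $A\in\Lambda_{\mathrm{ab}}(G)$, let $N_A$ be the intersection of all normal subgroups $N$ of $H$ with $N\le\operatorname{Ker}\tau$ such that $\operatorname{Ker}(H/N\twoheadrightarrow G)$ is isomorphic to $A$ as a $G$-module, where $G$ acts by conjugation via lifts ($N_A=\operatorname{Ker}\tau$ if there are none). Let $B_A=\operatorname{Ker}(H/N_A\twoheadrightarrow G)$, let $f_A\in H^2(G,B_A)$ be the class of the extension $1\to B_A\to H/N_A\to G\to1$, let $F_A=\operatorname{End}_G(A)$, let $B_A^*=\operatorname{Hom}_G(B_A,A)$ be the $F_A$-vector space of continuous $G$-homomorphisms, and let $S_A\colon B_A^*\to H^2(G,A)$ be the $F_A$-linear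 map $\varphi\mapsto\varphi_*(f_A)$ into continuous cohomology. Then $\operatorname{mult}_A(\tau)=\dim_{F_A}\operatorname{Ker}S_A$ (a cardinal) and $\operatorname{supp}_A(\tau)=\operatorname{Im}S_A\subseteq H^2(G,A)$. **Statement.** Let $\tau\colon H\twoheadrightarrow G$ and $\tau'\colon H'\twoheadrightarrow G$ be fundamental epimorphisms of profinite groups. 1. $\tau'\preccurlyeq\tau$ if and only if (1a) $\operatorname{mult}_\lambda(\tau')\le\operatorname{mult}_\lambda(\tau)$ for every $\lambda\in\Lambda(G)$, and (1b) $\operatorname{supp}_A(\tau')\subseteq\operatorname{supp}_A(\tau)$ for every $A\in\Lambda_{\mathrm{ab}}(G)$. 2. $\tau'\cong_G\tau$ if and only if (2a) $\operatorname{mult}_\lambda(\tau')=\operatorname{mult}_\lambda(\tau)$ for every $\lambda\in\Lambda(G)$, and (2b) $\operatorname{supp}_A(\tau')=\operatorname{supp}_A(\tau)$ for every $A\in\Lambda_{\mathrm{ab}}(G)$. -/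

import Mathlib

/-!
Profinite groups are compact totally disconnected topological groups (such groups are
automatically Hausdorff), homomorphisms are continuous, and an epimorphism of profinite groups
is a surjective continuous homomorphism.
-/

universe u

namespace Fundament

/-! ### Epimorphisms onto a fixed group -/

section Epimorphisms

variable {G H H' : Type u}
  [Group G] [TopologicalSpace G]
  [Group H] [TopologicalSpace H]
  [Group H'] [TopologicalSpace H']

/-- `Dominates τ τ'`: the epimorphism `τ'` onto `G` is dominated by the epimorphism `τ` onto `G`,
that is, `τ = τ' ∘ ψ` for some epimorphism `ψ`. -/
def Dominates (τ : H →ₜ* G) (τ' : H' →ₜ* G) : Prop :=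
  ∃ ψ : H →ₜ* H', Function.Surjective ψ ∧ ∀ h, τ' (ψ h) = τ h

/-- The isomorphism relation `τ ≅_G τ'` of epimorphisms onto `G`. -/
def IsoOver (τ : H →ₜ* G) (τ' : H' →ₜ* G) : Prop :=
  ∃ e : H ≃ₜ* H', ∀ h, τ' (e h) = τ h

/-- The epimorphism `H ⧸ N ↠ G` induced by `τ : H ↠ G`, for a normal subgroup `N ≤ Ker τ`. -/
def quotMap (τ : H →ₜ* G) (N : Subgroup H) [N.Normal] (hN : N ≤ τ.toMonoidHom.ker) :
    H ⧸ N →ₜ* G where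
  toMonoidHom := QuotientGroup.lift N τ.toMonoidHom hN
  continuous_toFun := τ.continuous_toFun.quotient_lift _

/-- `N ∈ 𝒩_M(H)`: `N` is maximal among the (closed) normal subgroups of `H` that are strictly
contained in `M`. -/
def IsMaxNormalBelow (M N : Subgroup H) : Prop :=
  Maximal (fun L : Subgroup H => IsClosed (L : Set H) ∧ L.Normal ∧ L < M) N

/-- The fundament kernel of `τ`: the intersection, inside `Ker τ`, of all `N ∈ 𝒩_{Ker τ}(H)`.
(If `Ker τ` is trivial, then the family is empty and the intersection is `Ker τ`.) -/
def fundamentKernel (τ : H →ₜ* G) : Subgroup H :=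
  τ.toMonoidHom.ker ⊓ sInf {N | IsMaxNormalBelow τ.toMonoidHom.ker N}

/-- `τ` is fundamental if its fundament kernel is trivial. -/
def IsFundamental (τ : H →ₜ* G) : Prop := fundamentKernel τ = ⊥

end Epimorphisms

/-- An epimorphism `φ : H ↠ G` of profinite groups is indecomposable if it is not an isomorphism
and whenever `φ = ρ ∘ ψ` with epimorphisms `ψ : H ↠ E` and `ρ : E ↠ G` of profinite groups,
then `ψ` or `ρ` is an isomorphism. -/
def IsIndecomposable {G H : Type u} [Group G] [TopologicalSpace G] [Group H] [TopologicalSpace H]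
    (φ : H →ₜ* G) : Prop :=
  ¬ IsHomeomorph φ ∧
    ∀ (E : Type u) [Group E] [TopologicalSpace E] [IsTopologicalGroup E] [CompactSpace E]
      [TotallyDisconnectedSpace E] (ψ : H →ₜ* E) (ρ : E →ₜ* G),
      Function.Surjective ψ → Function.Surjective ρ → (∀ h, ρ (ψ h) = φ h) →
        IsHomeomorph ψ ∨ IsHomeomorph ρ

/-- `φ` represents an element of `Λ_na(G)`: it is an indecomposable epimorphism onto `G` with
non-abelian kernel. -/
structure IsNonabelianIndecomposable {G H : Type u} [Group G] [TopologicalSpace G]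
    [Group H] [TopologicalSpace H] (φ : H →ₜ* G) : Prop where
  surjective : Function.Surjective φ
  indecomposable : IsIndecomposable φ
  ker_nonabelian : ¬ ∀ x ∈ φ.toMonoidHom.ker, ∀ y ∈ φ.toMonoidHom.ker, x * y = y * x

/-- The `ζ`-multiplicity of `τ`: the cardinality of the set `𝒞_ζ` of the (closed) normal
subgroups `N` of `H` contained in `Ker τ` such that `H ⧸ N ↠ G` is isomorphic to `ζ`. -/
noncomputable def multNa {G H E : Type u} [Group G] [TopologicalSpace G]
    [Group H] [TopologicalSpace H] [Group E] [TopologicalSpace E]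
    (ζ : E →ₜ* G) (τ : H →ₜ* G) : Cardinal.{u} :=
  Cardinal.mk {N : Subgroup H // IsClosed (N : Set H) ∧
    ∃ (_ : N.Normal) (hN : N ≤ τ.toMonoidHom.ker), IsoOver (quotMap τ N hN) ζ}

/-! ### Finite simple modules and the second cohomology -/

section Modules

variable (G A : Type u) [Group G] [AddCommGroup A] [DistribMulAction G A]

/-- `A` is a simple `G`-module: it is non-zero and has no submodules except `0` and `A`. -/
structure IsSimpleGModule : Prop where
  nontrivial : Nontrivial A
  eq_bot_or_eq_top : ∀ B : AddSubgroup A, (∀ (g : G), ∀ b ∈ B, g • b ∈ B) → B = ⊥ ∨ B = ⊤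

/-- The ring `F_A = End_G(A)`. It acts on `A` by `α • a = α a`. For a finite (hence discrete)
module `A`, every endomorphism is continuous. -/
def EndG : Subring (AddMonoid.End A) where
  carrier := {α | ∀ (g : G) (a : A), α (g • a) = g • α a}
  mul_mem' := by
    intro α β hα hβ g a
    change α (β (g • a)) = g • α (β a)
    rw [hβ g a, hα g]
  one_mem' := fun _ _ => rfl
  add_mem' := by
    intro α β hα hβ g a
    change α (g • a) + β (g • a) = g • (α a + β a)
    rw [hα g a, hβ g a, smul_add]
  zero_mem' := fun g _ => (smul_zero g).symm
  neg_mem' := by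
    intro α hα g a
    change -α (g • a) = g • (-α a)
    rw [hα g a, smul_neg]

variable {G A} in
theorem EndG.smul_smul_comm (α : EndG G A) (g : G) (a : A) : α • (g • a) = g • (α • a) :=
  α.2 g a

variable [TopologicalSpace G] [TopologicalSpace A] [DiscreteTopology A]

/-- The `F_A`-space `Z²(G, A)` of continuous non-homogeneous 2-cocycles. -/
def Z2 : Submodule (EndG G A) (G × G → A) where
  carrier := {f | Continuous f ∧
    ∀ g h j : G, f (g * h, j) + f (g, h) = g • f (h, j) + f (g, h * j)}
  zero_mem' := ⟨continuous_const, by simp⟩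
  add_mem' := by
    rintro f f' ⟨hf, hf2⟩ ⟨hf', hf2'⟩
    refine ⟨(continuous_of_discreteTopology (f := fun p : A × A => p.1 + p.2)).comp
      (hf.prodMk hf'), fun g h j => ?_⟩
    simp only [Pi.add_apply, smul_add]
    rw [add_add_add_comm, hf2, hf2', add_add_add_comm]
  smul_mem' := by
    rintro α f ⟨hf, hf2⟩
    refine ⟨(continuous_of_discreteTopology (f := fun a : A => α • a)).comp hf,
      fun g h j => ?_⟩
    simp only [Pi.smul_apply]
    rw [← smul_add, hf2, smul_add, EndG.smul_smul_comm]

/-- The `F_A`-space `B²(G, A)` of the coboundaries of continuous non-homogeneous 1-cochains. -/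
def B2 : Submodule (EndG G A) (G × G → A) where
  carrier := {f | ∃ x : G → A, Continuous x ∧
    ∀ g h : G, f (g, h) = g • x h - x (g * h) + x g}
  zero_mem' := ⟨0, continuous_const, by simp⟩
  add_mem' := by
    rintro f f' ⟨x, hx, hf⟩ ⟨x', hx', hf'⟩
    refine ⟨x + x', (continuous_of_discreteTopology (f := fun p : A × A => p.1 + p.2)).comp
      (hx.prodMk hx'), fun g h => ?_⟩
    simp only [Pi.add_apply, smul_add, hf, hf']
    abel
  smul_mem' := by
    rintro α f ⟨x, hx, hf⟩
    refine ⟨α • x, (continuous_of_discreteTopology (f := fun a : A => α • a)).comp hx,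
      fun g h => ?_⟩
    simp only [Pi.smul_apply]
    rw [hf, smul_add, smul_sub, EndG.smul_smul_comm]

/-- The continuous cohomology group `H²(G, A)`, a vector space over `F_A`. -/
abbrev H2 : Type u := Z2 G A ⧸ (B2 G A).submoduleOf (Z2 G A)

end Modules

/-! ### Extensions and the map `S` -/

section Extensions

variable {G X : Type u} [Group G] [TopologicalSpace G] [Group X] [TopologicalSpace X]
  (A : Type u) [AddCommGroup A] [DistribMulAction G A] [TopologicalSpace A] [DiscreteTopology A]

/-- For an epimorphism `π : X ↠ G` with kernel `B`, the `F_A`-space `B* = Hom_G(B, A)` of the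
continuous `G`-homomorphisms `φ : B → A`. Here `g ∈ G` acts on `B` as the conjugation by an
arbitrary `x ∈ X` such that `π x = g`. -/
def dual (π : X →ₜ* G) : Submodule (EndG G A) (π.toMonoidHom.ker → A) where
  carrier := {φ | Continuous φ ∧ (∀ b c, φ (b * c) = φ b + φ c) ∧
    ∀ (x : X) (b : π.toMonoidHom.ker),
      φ ⟨x * b * x⁻¹, π.toMonoidHom.normal_ker.conj_mem b b.2 x⟩ = π x • φ b}
  zero_mem' := ⟨continuous_const, fun _ _ => (add_zero 0).symm, fun x _ => (smul_zero (π x)).symm⟩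
  add_mem' := by
    rintro f f' ⟨hf, hm, he⟩ ⟨hf', hm', he'⟩
    refine ⟨(continuous_of_discreteTopology (f := fun p : A × A => p.1 + p.2)).comp
      (hf.prodMk hf'), fun b c => ?_, fun x b => ?_⟩
    · simp only [Pi.add_apply, hm, hm']; abel
    · simp only [Pi.add_apply, he, he', smul_add]
  smul_mem' := by
    rintro α f ⟨hf, hm, he⟩
    refine ⟨(continuous_of_discreteTopology (f := fun a : A => α • a)).comp hf,
      fun b c => ?_, fun x b => ?_⟩
    · simp only [Pi.smul_apply, hm, smul_add]
    · simp only [Pi.smul_apply, he, EndG.smul_smul_comm]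

/-- The kernel of `π : X ↠ G` is isomorphic to `A` as a `G`-module (with the conjugation action). -/
def KerIso (π : X →ₜ* G) : Prop := ∃ φ ∈ dual A π, IsHomeomorph φ

/-- `u` is a continuous section of `π`. -/
structure IsContSection (π : X →ₜ* G) (u : G → X) : Prop where
  continuous : Continuous u
  section_apply : ∀ g, π (u g) = g

/-- The factor set `f` of the extension `π : X ↠ G` with respect to a section `u`:
`u g * u h = f (g, h) * u (g * h)`. -/
def factorSet (π : X →ₜ* G) (u : G → X) (hu : IsContSection π u) (p : G × G) :
    π.toMonoidHom.ker :=
  ⟨u p.1 * u p.2 * (u (p.1 * p.2))⁻¹, by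
    change π (u p.1 * u p.2 * (u (p.1 * p.2))⁻¹) = 1
    simp [map_mul, map_inv, hu.section_apply]⟩

variable {A} in
theorem comp_factorSet_mem_Z2 [ContinuousMul G] [IsTopologicalGroup X] (π : X →ₜ* G)
    (u : G → X) (hu : IsContSection π u) (φ : dual A π) :
    (fun p => φ.1 (factorSet π u hu p)) ∈ Z2 G A := by
  obtain ⟨φ, hc, hm, he⟩ := φ
  refine ⟨hc.comp (Continuous.subtype_mk ?_ _), fun g h j => ?_⟩
  · have := hu.continuous
    fun_prop
  · simp only
    have key := he (u g) (factorSet π u hu (h, j))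
    rw [hu.section_apply] at key
    rw [← key, add_comm (φ (factorSet π u hu (g * h, j))), ← hm, ← hm]
    congr 1
    ext
    simp only [factorSet, Subgroup.coe_mul]
    group

/-- The `F_A`-linear map `S : B* → H²(G, A)`, `φ ↦ φ_* f`, where `f ∈ H²(G, B)` is the class of
the extension `π : X ↠ G` with kernel `B`, represented by the factor set of a section `u`. -/
def pushClass [ContinuousMul G] [IsTopologicalGroup X] (π : X →ₜ* G)
    (u : G → X) (hu : IsContSection π u) : dual A π →ₗ[EndG G A] H2 G A :=
  ((B2 G A).submoduleOf (Z2 G A)).mkQ ∘ₗ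
    { toFun := fun φ => ⟨fun p => φ.1 (factorSet π u hu p), comp_factorSet_mem_Z2 π u hu φ⟩
      map_add' := fun _ _ => rfl
      map_smul' := fun _ _ => rfl }

variable {A} in
/-- The map `S` does not depend on the section. -/
theorem pushClass_eq [IsTopologicalGroup G] [IsTopologicalGroup X] (π : X →ₜ* G) (u v : G → X)
    (hu : IsContSection π u) (hv : IsContSection π v) :
    pushClass A π u hu = pushClass A π v hv := by
  ext φ
  obtain ⟨φ, hc, hm, he⟩ := φ
  have hw : ∀ g, u g * (v g)⁻¹ ∈ π.toMonoidHom.ker := fun g => by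
    change π (u g * (v g)⁻¹) = 1
    simp [hu.section_apply, hv.section_apply]
  have := hu.continuous
  have := hv.continuous
  refine (Submodule.Quotient.eq _).2 ?_
  refine ⟨fun g => φ ⟨_, hw g⟩, hc.comp (Continuous.subtype_mk (by fun_prop) _), fun g h => ?_⟩
  change φ (factorSet π u hu (g,h)) - φ (factorSet π v hv (g,h)) = g • φ ⟨_, hw h⟩ - φ ⟨_, hw (g*h)⟩ + φ ⟨_, hw g⟩
  have key := he (v g) ⟨_, hw h⟩
  rw [hv.section_apply] at key
  rw [← key, sub_eq_iff_eq_add, ← sub_eq_zero]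
  have : φ ⟨_, hw (g*h)⟩ + φ (factorSet π u hu (g,h)) =
    φ ⟨_, hw g⟩ + φ ⟨v g * (u h * (v h)⁻¹) * (v g)⁻¹, π.toMonoidHom.normal_ker.conj_mem _ (hw h) _⟩ + φ (factorSet π v hv (g,h)) := by
    have hh : φ ⟨_, hw (g*h)⟩ + φ (factorSet π u hu (g,h)) = φ (factorSet π u hu (g,h)) + φ ⟨_, hw (g*h)⟩ := add_comm _ _
    rw [hh, ← hm, ← hm]
    have h2 : ∀ p q : π.toMonoidHom.ker, φ (p * q) = φ (q * p) := fun p q => by rw [hm, hm, add_comm]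
    rw [← hm]
    congr 1
    ext
    simp only [factorSet, Subgroup.coe_mul]
    group
  rw [eq_sub_of_add_eq' this]
  abel

end Extensions

/-! ### Continuous sections -/

/-- An approximate section of `τ`: a closed set `C` of representatives of `G` in `H` modulo the
closed subgroup `S` of `Ker τ`. -/
structure IsApproxSection {G H : Type u} [Group G] [TopologicalSpace G]
    [Group H] [TopologicalSpace H] (τ : H →ₜ* G) (p : Subgroup H × Set H) : Prop where
  closed_left : IsClosed (p.1 : Set H)
  le_ker : ∀ s ∈ p.1, τ s = 1
  closed_right : IsClosed p.2
  mul_mem : ∀ c ∈ p.2, ∀ s ∈ p.1, c * s ∈ p.2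
  inv_mul_mem : ∀ c ∈ p.2, ∀ d ∈ p.2, τ c = τ d → c⁻¹ * d ∈ p.1
  surj : ∀ g, ∃ c ∈ p.2, τ c = g

/-- An epimorphism of profinite groups has a continuous section. -/
theorem exists_isContSection {G H : Type u} [Group G] [TopologicalSpace G]
    [IsTopologicalGroup G] [TotallyDisconnectedSpace G]
    [Group H] [TopologicalSpace H] [IsTopologicalGroup H] [CompactSpace H]
    [TotallyDisconnectedSpace H] (τ : H →ₜ* G) (hτ : Function.Surjective τ) :
    ∃ u : G → H, IsContSection τ u := by
  have hτc : Continuous τ := τ.continuous_toFun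
  have h0 : IsApproxSection τ (τ.toMonoidHom.ker, Set.univ) :=
    { closed_left := isClosed_singleton.preimage hτc
      le_ker := fun s hs => hs
      closed_right := isClosed_univ
      mul_mem := fun _ _ _ _ => trivial
      inv_mul_mem := fun c _ d _ h => by
        change τ (c⁻¹ * d) = 1
        simp [h]
      surj := fun g => (hτ g).imp fun _ h => ⟨trivial, h⟩ }
  obtain ⟨⟨S, C⟩, hSC⟩ : ∃ p : (Subgroup H × Set H)ᵒᵈ,
      Maximal (fun q : (Subgroup H × Set H)ᵒᵈ => IsApproxSection τ (OrderDual.ofDual q)) p := by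
    refine zorn_le₀ {q : (Subgroup H × Set H)ᵒᵈ | IsApproxSection τ (OrderDual.ofDual q)} ?_
    intro c hc hchain
    rcases c.eq_empty_or_nonempty with rfl | hne
    · exact ⟨_, h0, by simp⟩
    have : Nonempty c := hne.to_subtype
    refine ⟨OrderDual.toDual (⨅ q : c, (OrderDual.ofDual q.1).1,
      ⋂ q : c, (OrderDual.ofDual q.1).2), ?_, ?_⟩
    · refine ⟨?_, ?_, ?_, ?_, ?_, ?_⟩
      · simp only [OrderDual.ofDual_toDual, Subgroup.coe_iInf]
        exact isClosed_iInter fun q => (hc q.2).closed_left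
      · intro s hs
        obtain ⟨q⟩ := this
        exact (hc q.2).le_ker s (Subgroup.mem_iInf.1 hs q)
      · exact isClosed_iInter fun q => (hc q.2).closed_right
      · intro x hx s hs
        refine Set.mem_iInter.2 fun q => (hc q.2).mul_mem x (Set.mem_iInter.1 hx q) s
          (Subgroup.mem_iInf.1 hs q)
      · intro x hx y hy h
        exact Subgroup.mem_iInf.2 fun q => (hc q.2).inv_mul_mem x (Set.mem_iInter.1 hx q) y
          (Set.mem_iInter.1 hy q) h
      · intro g
        have hcl : ∀ q : c, IsClosed ((OrderDual.ofDual q.1).2 ∩ τ ⁻¹' {g}) := fun q =>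
          (hc q.2).closed_right.inter (isClosed_singleton.preimage hτc)
        obtain ⟨x, hx⟩ := IsCompact.nonempty_iInter_of_directed_nonempty_isCompact_isClosed
          (fun q : c => (OrderDual.ofDual q.1).2 ∩ τ ⁻¹' {g}) (by
            intro q r
            rcases hchain.total q.2 r.2 with h | h
            · exact ⟨r, Set.inter_subset_inter_left _ h.2, le_rfl⟩
            · exact ⟨q, le_rfl, Set.inter_subset_inter_left _ h.2⟩)
          (fun q => by
            obtain ⟨x, hx, hxg⟩ := (hc q.2).surj g
            exact ⟨x, hx, hxg⟩)
          (fun q => (hcl q).isCompact) hcl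
        obtain ⟨q⟩ := this
        exact ⟨x, Set.mem_iInter.2 fun r => (Set.mem_iInter.1 hx r).1,
          (Set.mem_iInter.1 hx q).2⟩
    · intro q hq
      exact ⟨iInf_le (fun q : c => (OrderDual.ofDual q.1).1) ⟨q, hq⟩,
        Set.iInter_subset (fun q : c => (OrderDual.ofDual q.1).2) ⟨q, hq⟩⟩
  have hS := hSC.prop
  have hbot : S = ⊥ := by
    by_contra hne
    obtain ⟨⟨s₀, hs₀⟩, hs⟩ := Subgroup.ne_bot_iff_exists_ne_one.1 hne
    have hs1 : s₀ ≠ 1 := fun h => hs (Subtype.ext h)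
    obtain ⟨U, hU⟩ := ProfiniteGrp.exist_openNormalSubgroup_sub_open_nhds_of_one
      (isOpen_compl_singleton (x := s₀)) (fun h => hs1 (Set.mem_singleton_iff.1 h).symm)
    have hfin : Finite (H ⧸ U.toSubgroup) := U.toSubgroup.quotient_finite_of_isOpen U.isOpen
    obtain ⟨n, ⟨e⟩⟩ := Finite.exists_equiv_fin (H ⧸ U.toSubgroup)
    let r : H → ℕ := fun h => (e (h : H ⧸ U.toSubgroup)).1
    have hr : ∀ x y : H, r x = r y ↔ x⁻¹ * y ∈ U.toSubgroup := fun x y => by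
      rw [← QuotientGroup.eq]
      exact ⟨fun h => e.injective (Fin.ext h), fun h => by simp only [r, h]⟩
    have hdisc : DiscreteTopology (H ⧸ U.toSubgroup) := QuotientGroup.discreteTopology U.isOpen
    have hrc : Continuous r :=
      (continuous_of_discreteTopology (f := fun q => (e q).1)).comp QuotientGroup.continuous_mk
    have hnew : IsApproxSection τ (S ⊓ U.toSubgroup, {c | c ∈ C ∧ ∀ s ∈ S, r c ≤ r (c * s)}) := by
      refine ⟨?_, ?_, ?_, ?_, ?_, ?_⟩
      · exact hS.closed_left.inter (U.toSubgroup.isClosed_of_isOpen U.isOpen)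
      · exact fun s hs => hS.le_ker s hs.1
      · refine hS.closed_right.inter ?_
        have heq : {c : H | ∀ s ∈ S, r c ≤ r (c * s)} = ⋂ s, ⋂ _ : s ∈ S, {c | r c ≤ r (c * s)} := by
          ext c
          simp
        change IsClosed {c : H | ∀ s ∈ S, r c ≤ r (c * s)}
        rw [heq]
        refine isClosed_iInter fun s => isClosed_iInter fun _ => ?_
        exact isClosed_le hrc (hrc.comp (continuous_mul_const s))
      · rintro c ⟨hc, hmin⟩ s ⟨hs, hsU⟩
        refine ⟨hS.mul_mem c hc s hs, fun t ht => ?_⟩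
        have h1 : r (c * s) = r c := ((hr c (c * s)).2 (by simpa using hsU)).symm
        rw [h1, mul_assoc]
        exact hmin _ (S.mul_mem hs ht)
      · rintro c ⟨hc, hmin⟩ d ⟨hd, hmin'⟩ h
        have h1 := hS.inv_mul_mem c hc d hd h
        have h2 := hS.inv_mul_mem d hd c hc h.symm
        refine ⟨h1, (hr c d).1 (le_antisymm ?_ ?_)⟩
        · simpa using hmin _ h1
        · simpa using hmin' _ h2
      · intro g
        obtain ⟨c, hc, hcg⟩ := hS.surj g
        classical
        have hex : ∃ n, ∃ s ∈ S, r (c * s) = n := ⟨_, 1, S.one_mem, rfl⟩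
        obtain ⟨s, hs, hrs⟩ := Nat.find_spec hex
        refine ⟨c * s, ⟨hS.mul_mem c hc s hs, fun t ht => ?_⟩, ?_⟩
        · rw [hrs, mul_assoc]
          exact Nat.find_min' hex ⟨s * t, S.mul_mem hs ht, rfl⟩
        · rw [map_mul, hS.le_ker s hs, mul_one, hcg]
    have hle := (hSC.le_of_ge (y := OrderDual.toDual
      (S ⊓ U.toSubgroup, {c | c ∈ C ∧ ∀ s ∈ S, r c ≤ r (c * s)})) hnew
      ⟨inf_le_left, fun c hc => hc.1⟩).1
    exact hU (hle hs₀).2 rfl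
  choose u huC hu using hS.surj
  have huniq : ∀ c ∈ C, u (τ c) = c := fun c hc => by
    have h : (u (τ c))⁻¹ * c ∈ S := hS.inv_mul_mem _ (huC (τ c)) c hc (hu _)
    rw [hbot, Subgroup.mem_bot] at h
    exact (inv_mul_eq_one.1 h)
  refine ⟨u, continuous_iff_isClosed.2 fun F hF => ?_, hu⟩
  have : u ⁻¹' F = τ '' (C ∩ F) := by
    ext g
    constructor
    · exact fun h => ⟨u g, ⟨huC g, h⟩, hu g⟩
    · rintro ⟨c, ⟨hc, hcF⟩, rfl⟩
      simpa [huniq c hc] using hcF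
  rw [this]
  exact ((hS.closed_right.inter hF).isCompact.image hτc).isClosed

/-! ### The invariants at a finite simple module -/

section Invariants

variable {G H : Type u} [Group G] [TopologicalSpace G] [Group H] [TopologicalSpace H]
  (A : Type u) [AddCommGroup A] [DistribMulAction G A] [TopologicalSpace A] [DiscreteTopology A]
  (τ : H →ₜ* G)

/-- `N ∈ 𝒞_A`: `N` is a (closed) normal subgroup of `H` contained in `Ker τ` such that the kernel
of `H ⧸ N ↠ G` is isomorphic to `A` as a `G`-module. -/
def MemCA (N : Subgroup H) : Prop :=
  IsClosed (N : Set H) ∧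
    ∃ (_ : N.Normal) (hN : N ≤ τ.toMonoidHom.ker), KerIso A (quotMap τ N hN)

/-- `N_A`: the intersection, inside `Ker τ`, of all `N ∈ 𝒞_A`. -/
def NA : Subgroup H := τ.toMonoidHom.ker ⊓ ⨅ N : {N : Subgroup H // MemCA A τ N}, N.1

theorem NA_le : NA A τ ≤ τ.toMonoidHom.ker := inf_le_left

instance NA_normal : (NA A τ).Normal := by
  have : (⨅ N : {N : Subgroup H // MemCA A τ N}, N.1).Normal :=
    Subgroup.normal_iInf_normal fun N => N.2.2.1
  exact Subgroup.normal_inf_normal _ _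

/-- The induced epimorphism `τ_A : H_A ↠ G`, where `H_A = H ⧸ N_A`. Its kernel is `B_A`. -/
def barA : H ⧸ NA A τ →ₜ* G := quotMap τ (NA A τ) (NA_le A τ)

variable [IsTopologicalGroup G] [TotallyDisconnectedSpace G] [IsTopologicalGroup H]
  [CompactSpace H] [TotallyDisconnectedSpace H]

theorem exists_isContSection_barA (hτ : Function.Surjective τ) :
    ∃ u : G → H ⧸ NA A τ, IsContSection (barA A τ) u := by
  obtain ⟨u, hu⟩ := exists_isContSection τ hτ
  exact ⟨fun g => (u g : H ⧸ NA A τ),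
    (QuotientGroup.continuous_mk).comp hu.continuous, hu.section_apply⟩

/-- The `F_A`-linear map `S_A : B_A* → H²(G, A)` of the epimorphism `τ`. By
`pushClass_eq` it does not depend on the section chosen. -/
noncomputable def SA (hτ : Function.Surjective τ) :
    dual A (barA A τ) →ₗ[EndG G A] H2 G A :=
  pushClass A (barA A τ) (exists_isContSection_barA A τ hτ).choose
    (exists_isContSection_barA A τ hτ).choose_spec

/-- The `A`-multiplicity of `τ`: the dimension of `Ker S_A` over `F_A`. -/
noncomputable def multAb (hτ : Function.Surjective τ) : Cardinal.{u} :=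
  Module.rank (EndG G A) (LinearMap.ker (SA A τ hτ))

/-- The `A`-support of `τ`: the subspace `Im S_A` of `H²(G, A)`. -/
noncomputable def suppAb (hτ : Function.Surjective τ) : Submodule (EndG G A) (H2 G A) :=
  LinearMap.range (SA A τ hτ)

end Invariants

end Fundament

namespace Fundament

/-! ### Closed normal subgroups of profinite groups -/

section Algebra

variable {H : Type u} [Group H]

/-! Write `K` and `K'` for the kernels of `τ` and `τ'`. A nonzero equivariant homomorphism from `K`
to a simple module `A` has kernel in the family defining `N_A`, so all of these homomorphisms factor
through `B_A`. The multiplicity and support at `A` can therefore be read off from the map `S` on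
`Hom_G(K, A)` itself (`exists_equiv_dual_barA`). An epimorphism over `G` pulls normal subgroups and
homomorphisms back injectively, and compatibly with `S`. This gives the necessity of the conditions.

For sufficiency, the non-abelian maximal normal subgroups below `K'` are matched injectively with
such subgroups below `K` having isomorphic quotients over `G`. For each simple `A`, the inequality
of multiplicities and the inclusion of supports give an injective linear map `Θ : Hom_G(K', A) →
Hom_G(K, A)` over `H²(G, A)`. A basis `c'` of the source is matched with `c = Θ c'`.

Equality in `H²` means that the pushed-out factor sets of `c'` and `c` differ by a coboundary. After
correction by a cochain, each matched pair thus gives a crossed homomorphism on the fibre product of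
`H` and `H'` over `G`. Let `Γ` be the closed subgroup where all of these vanish and all matched
quotients agree. Independence of the families makes both projections of `Γ` surjective: non-abelian
factors are independent by commutators, abelian ones by Schur's lemma and linear independence, and
compactness passes from finitely many conditions to all (`exists_ker_of_independent`). Since `τ'` is
fundamental, the chosen family separates the points of `K'`, so `Γ` is the graph of an epimorphism
`H ↠ H'` (`exists_hom_of_isIndependent`). If all invariants agree, the matching is exhaustive on the
side of `H` too, and the epimorphism is injective. -/

theorem commutator_le_of_sup_eq {K N D₁ D₂ : Subgroup H} [N.Normal] (h₁ : D₁ ⊔ N = K)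
    (h₂ : D₂ ⊔ N = K) (h : ⁅D₁, D₂⁆ ≤ N) : ⁅K, K⁆ ≤ N := by
  refine Subgroup.commutator_le.2 fun x hx y hy => ?_
  rw [← h₁] at hx
  rw [← h₂] at hy
  obtain ⟨a, ha, n, hn, rfl⟩ := Subgroup.mem_sup_of_normal_right.1 hx
  obtain ⟨b, hb, m, hm, rfl⟩ := Subgroup.mem_sup_of_normal_right.1 hy
  -- Modulo `N`, the elements `x` and `y` agree with `a ∈ D₁` and `b ∈ D₂`, so their commutator
  -- agrees with that of `a` and `b`.
  have hab := (QuotientGroup.eq_one_iff (N := N) _).2 (h (Subgroup.commutator_mem_commutator ha hb))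
  rw [← QuotientGroup.eq_one_iff, ← hab]
  have h1 := (QuotientGroup.eq_one_iff (N := N) n).2 hn
  have h2 := (QuotientGroup.eq_one_iff (N := N) m).2 hm
  simp [commutatorElement_def, h1, h2]

/-- The intersection, inside `K`, of a finite subfamily of a family of subgroups. -/
def finInf {ι : Type*} (K : Subgroup H) (M : ι → Subgroup H) (S : Finset ι) : Subgroup H :=
  K ⊓ ⨅ y ∈ S, M y

theorem mem_finInf {ι : Type*} {K : Subgroup H} {M : ι → Subgroup H} {S : Finset ι} {h : H} :
    h ∈ finInf K M S ↔ h ∈ K ∧ ∀ y ∈ S, h ∈ M y := by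
  simp [finInf, Subgroup.mem_iInf]

theorem finInf_insert {ι : Type*} [DecidableEq ι] {K : Subgroup H} {M : ι → Subgroup H}
    {S : Finset ι} {x : ι} : finInf K M (insert x S) = finInf K M S ⊓ M x := by
  ext h
  simp only [Subgroup.mem_inf, mem_finInf, Finset.mem_insert, forall_eq_or_imp]
  tauto

theorem finInf_le {ι : Type*} {K : Subgroup H} {M : ι → Subgroup H} {S : Finset ι} :
    finInf K M S ≤ K := inf_le_left

theorem normal_finInf {ι : Type*} {K : Subgroup H} [K.Normal] {M : ι → Subgroup H}
    (hM : ∀ x, (M x).Normal) (S : Finset ι) : (finInf K M S).Normal :=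
  ⟨fun h hh g => mem_finInf.2 ⟨Subgroup.Normal.conj_mem ‹_› h (mem_finInf.1 hh).1 g,
    fun y hy => (hM y).conj_mem h ((mem_finInf.1 hh).2 y hy) g⟩⟩

end Algebra

section Topology

variable {H : Type u} [Group H] [TopologicalSpace H]

theorem IsMaxNormalBelow.eq_of_le {K N L : Subgroup H} (hN : IsMaxNormalBelow K N)
    (hL : IsMaxNormalBelow K L) (h : N ≤ L) : N = L :=
  le_antisymm h (hN.2 hL.1 h)

theorem isClosed_finInf {ι : Type*} {K : Subgroup H} (hK : IsClosed (K : Set H))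
    {M : ι → Subgroup H} (hM : ∀ x, IsClosed (M x : Set H)) (S : Finset ι) :
    IsClosed (finInf K M S : Set H) := by
  have : ((finInf K M S : Subgroup H) : Set H) = (K : Set H) ∩ ⋂ y ∈ S, (M y : Set H) := by
    ext h
    simp [mem_finInf]
  rw [this]
  exact hK.inter (isClosed_biInter fun y _ => hM y)

end Topology

/-! ### Maximal closed normal subgroups: supplements, finiteness, independence. -/

section ClosedNormal

variable {H : Type u} [Group H] [TopologicalSpace H] [IsTopologicalGroup H] [CompactSpace H]
  [TotallyDisconnectedSpace H]

theorem isClosed_sup {D N : Subgroup H} [N.Normal] (hD : IsClosed (D : Set H))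
    (hN : IsClosed (N : Set H)) : IsClosed ((D ⊔ N : Subgroup H) : Set H) := by
  rw [Subgroup.mul_normal D N]
  exact (hD.isCompact.mul hN.isCompact).isClosed

/-- The complement of `L` is open, so the coset `xU` misses `L` for a small open normal `U`. -/
theorem exists_open_normal_notMem_sup {L : Subgroup H} (hL : IsClosed (L : Set H)) {x : H}
    (hx : x ∉ L) : ∃ U : OpenNormalSubgroup H, x ∉ L ⊔ U.toSubgroup := by
  obtain ⟨U, hU⟩ := ProfiniteGrp.exist_openNormalSubgroup_sub_open_nhds_of_one
    (U := {u | x * u ∉ L}) (hL.isOpen_compl.preimage (continuous_const_mul x)) (by simpa using hx)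
  refine ⟨U, fun h => ?_⟩
  obtain ⟨l, hl, v, hv, rfl⟩ := Subgroup.mem_sup_of_normal_right.1 h
  exact hU (U.toSubgroup.inv_mem hv) (by simpa using hl)

/-- The image of an open normal subgroup avoiding `a⁻¹b` modulo `L` is clopen, and its coset through
`a` separates the two points. This makes `H ⧸ L` an admissible middle group in the definition of
indecomposability. -/
theorem totallyDisconnectedSpace_quotient (L : Subgroup H) [L.Normal]
    (hL : IsClosed (L : Set H)) : TotallyDisconnectedSpace (H ⧸ L) := by
  have : TotallySeparatedSpace (H ⧸ L) := by
    refine totallySeparatedSpace_iff_exists_isClopen.2 fun x y hxy => ?_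
    obtain ⟨a, rfl⟩ := QuotientGroup.mk_surjective x
    obtain ⟨b, rfl⟩ := QuotientGroup.mk_surjective y
    have hab : a⁻¹ * b ∉ L := fun h => hxy (QuotientGroup.eq.2 h)
    obtain ⟨U, hU⟩ := exists_open_normal_notMem_sup hL hab
    have ho : IsOpen ((U.toSubgroup.map (QuotientGroup.mk' L) : Subgroup (H ⧸ L)) : Set (H ⧸ L)) :=
      QuotientGroup.isOpenMap_coe _ U.isOpen
    refine ⟨(fun z => (a : H ⧸ L)⁻¹ * z) ⁻¹' (U.toSubgroup.map (QuotientGroup.mk' L)),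
      ⟨(Subgroup.isClosed_of_isOpen _ ho).preimage (continuous_const_mul _),
        ho.preimage (continuous_const_mul _)⟩, ?_, ?_⟩
    · simp only [Set.mem_preimage, inv_mul_cancel]
      exact Subgroup.one_mem _
    · rintro ⟨v, hv, hvab⟩
      refine hU ?_
      have h1 : v⁻¹ * (a⁻¹ * b) ∈ L := QuotientGroup.eq.1 hvab
      have : v * (v⁻¹ * (a⁻¹ * b)) ∈ L ⊔ U.toSubgroup :=
        Subgroup.mul_mem _ (Subgroup.mem_sup_right hv) (Subgroup.mem_sup_left h1)
      simpa using this
  infer_instance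

theorem IsMaxNormalBelow.sup_eq {K N D : Subgroup H} (hN : IsMaxNormalBelow K N)
    (hDc : IsClosed (D : Set H)) [hD : D.Normal] (hDK : D ≤ K) (h : ¬ D ≤ N) : D ⊔ N = K := by
  have := hN.1.2.1
  by_contra hne
  refine h (le_sup_left.trans (hN.2 ⟨?_, inferInstance, lt_of_le_of_ne ?_ hne⟩ le_sup_right))
  · exact isClosed_sup hDc hN.1.1
  · exact sup_le hDK hN.1.2.2.le

/-- Take `k ∈ K` outside `N` and `U` with `k ∉ NU`. Then `NU ∩ K` is closed, normal, contains `N`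
and misses `k`, so maximality forces it into `N`. This is the source of the finiteness of `K / N`.
-/
theorem IsMaxNormalBelow.exists_open {K N : Subgroup H} [K.Normal] (hK : IsClosed (K : Set H))
    (hN : IsMaxNormalBelow K N) : ∃ U : OpenNormalSubgroup H, U.toSubgroup ⊓ K ≤ N := by
  have := hN.1.2.1
  obtain ⟨k, hk, hkN⟩ := SetLike.exists_of_lt hN.1.2.2
  obtain ⟨U, hU⟩ := exists_open_normal_notMem_sup hN.1.1 hkN
  refine ⟨U, (inf_le_inf_right K le_sup_right).trans
    (hN.2 (y := (N ⊔ U.toSubgroup) ⊓ K) ⟨?_, inferInstance, ?_⟩ (le_inf le_sup_left hN.1.2.2.le))⟩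
  · exact (isClosed_sup hN.1.1 (U.toSubgroup.isClosed_of_isOpen U.isOpen)).inter hK
  · exact lt_of_le_of_ne inf_le_right fun h => hU (h.ge hk).1

/-- An independent family of maximal normal subgroups satisfies the Chinese remainder theorem. -/
theorem exists_mem_cosets {ι : Type*} {K : Subgroup H} [K.Normal] (hK : IsClosed (K : Set H))
    (M : ι → Subgroup H) (hM : ∀ x, IsMaxNormalBelow K (M x))
    (hind : ∀ (S : Finset ι) (x : ι), x ∉ S → ¬ finInf K M S ≤ M x)
    (t : ι → H) (ht : ∀ x, t x ∈ K) : ∃ k ∈ K, ∀ x, (t x)⁻¹ * k ∈ M x := by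
  classical
  have hfin : ∀ S : Finset ι, ∃ k ∈ K, ∀ x ∈ S, (t x)⁻¹ * k ∈ M x := by
    intro S
    induction S using Finset.induction_on with
    | empty => exact ⟨1, K.one_mem, by simp⟩
    | insert x S hx ih =>
      obtain ⟨k, hk, hkS⟩ := ih
      have := normal_finInf (K := K) (fun y => (hM y).1.2.1) S
      have := (hM x).1.2.1
      -- By independence the intersection over `S` supplements `M x`, so `k` can be corrected at `x`
      -- by an element `d` that leaves the congruences in `S` intact.
      have hsup := (hM x).sup_eq (isClosed_finInf hK (fun y => (hM y).1.1) S) finInf_le (hind S x hx)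
      obtain ⟨d, hd, m, hm, hdm⟩ := Subgroup.mem_sup_of_normal_right.1
        (hsup.ge (K.mul_mem (K.inv_mem hk) (ht x)))
      refine ⟨k * d, K.mul_mem hk (finInf_le hd), fun y hy => ?_⟩
      rcases Finset.mem_insert.1 hy with rfl | hy
      · have : (t y)⁻¹ * (k * d) = m⁻¹ := by
          rw [← mul_inv_eq_iff_eq_mul.2 (eq_mul_of_inv_mul_eq hdm.symm)]
          group
        rw [this]
        exact Subgroup.inv_mem _ hm
      · rw [← mul_assoc]
        exact Subgroup.mul_mem _ (hkS y hy) ((mem_finInf.1 hd).2 y hy)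
  -- Finitely many congruences are solvable, and each defines a closed set; compactness of `K`
  -- solves all of them.
  obtain ⟨k, hk, hk'⟩ := hK.isCompact.inter_iInter_nonempty
    (fun x => {k | (t x)⁻¹ * k ∈ M x})
    (fun x => (hM x).1.1.preimage (continuous_const_mul _)) (fun S => by
      obtain ⟨k, hk, hkS⟩ := hfin S
      exact ⟨k, hk, Set.mem_iInter₂.2 hkS⟩)
  exact ⟨k, hk, Set.mem_iInter.1 hk'⟩

/-- A non-abelian maximal `N` behaves like a prime ideal. If `D` and `M x` are not inside `N`, both
supplement it in `K`; were `D ∩ M x` in `N`, so would be `[D, M x]`, and `K / N` would be abelian.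
-/
theorem not_finInf_le_of_nonabelian {ι : Type*} {K : Subgroup H} [K.Normal]
    (hK : IsClosed (K : Set H)) (M : ι → Subgroup H) (hM : ∀ x, IsMaxNormalBelow K (M x))
    {N : Subgroup H} (hN : IsMaxNormalBelow K N) (hNna : ¬ ⁅K, K⁆ ≤ N) (S : Finset ι)
    (hS : ∀ x ∈ S, ¬ M x ≤ N) : ¬ finInf K M S ≤ N := by
  classical
  have := hN.1.2.1
  induction S using Finset.induction_on with
  | empty => exact fun h => hN.1.2.2.not_ge fun k hk => h (mem_finInf.2 ⟨hk, by simp⟩)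
  | insert x S hx ih =>
    rw [finInf_insert]
    intro h
    have := normal_finInf (K := K) (fun y => (hM y).1.2.1) S
    have := (hM x).1.2.1
    refine hNna (commutator_le_of_sup_eq
      (hN.sup_eq (isClosed_finInf hK (fun y => (hM y).1.1) S) finInf_le
        (ih fun y hy => hS y (Finset.mem_insert_of_mem hy)))
      (hN.sup_eq (hM x).1.1 (hM x).1.2.2.le (hS x (Finset.mem_insert_self _ _)))
      ((Subgroup.commutator_le_inf _ _).trans h))

/-- A non-abelian factor imposes no condition on abelian quotients. Since `[D, D]` lies in `D ∩ L`
but not in `N`, the group `D ∩ L` supplements `N`. Hence each `d ∈ D` is `l * n` with `l ∈ D ∩ L`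
and `n ∈ D ∩ N ≤ L`. -/
theorem le_of_inf_le_of_nonabelian {K N L D : Subgroup H} [D.Normal] (hDc : IsClosed (D : Set H))
    (hDK : D ≤ K) (hN : IsMaxNormalBelow K N) (hNna : ¬ ⁅K, K⁆ ≤ N) [L.Normal]
    (hLc : IsClosed (L : Set H)) (hL : ⁅K, K⁆ ≤ L) (hDN : ¬ D ≤ N) (h : D ⊓ N ≤ L) : D ≤ L := by
  have := hN.1.2.1
  have hsup := hN.sup_eq hDc hDK hDN
  have h1 : ¬ D ⊓ L ≤ N := fun h1 => hNna (commutator_le_of_sup_eq hsup hsup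
    ((le_inf (Subgroup.commutator_le_left D D)
      ((Subgroup.commutator_mono hDK hDK).trans hL)).trans h1))
  have h2 := hN.sup_eq (D := D ⊓ L) (hDc.inter hLc) (inf_le_left.trans hDK) h1
  intro d hd
  obtain ⟨l, hl, n, hn, rfl⟩ := Subgroup.mem_sup_of_normal_right.1 (h2.ge (hDK hd))
  have : l⁻¹ * (l * n) ∈ D := D.mul_mem (D.inv_mem hl.1) hd
  exact L.mul_mem hl.2 (h ⟨by simpa using this, hn⟩)

end ClosedNormal

/-! ### Homomorphisms from the kernel to a module -/

section Dual

variable {G H : Type u} [Group G] [TopologicalSpace G] [Group H] [TopologicalSpace H]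
  {A : Type u} [AddCommGroup A] [DistribMulAction G A] [TopologicalSpace A] [DiscreteTopology A]
  {τ : H →ₜ* G}

theorem dual_mul (φ : dual A τ) (b c : τ.toMonoidHom.ker) : φ.1 (b * c) = φ.1 b + φ.1 c :=
  φ.2.2.1 b c

theorem dual_one (φ : dual A τ) : φ.1 1 = 0 := by
  have := dual_mul φ 1 1
  rwa [mul_one, left_eq_add] at this

theorem dual_inv (φ : dual A τ) (b : τ.toMonoidHom.ker) : φ.1 b⁻¹ = - φ.1 b := by
  rw [eq_neg_iff_add_eq_zero, ← dual_mul, inv_mul_cancel, dual_one]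

theorem dual_conj (φ : dual A τ) (x : H) (b : τ.toMonoidHom.ker) :
    φ.1 ⟨x * b * x⁻¹, τ.toMonoidHom.normal_ker.conj_mem b b.2 x⟩ = τ x • φ.1 b :=
  φ.2.2.2 x b

/-- The kernel of an element of the dual, as a subgroup of the whole group. -/
def dualKer (φ : dual A τ) : Subgroup H where
  carrier := {h | ∃ hk : h ∈ τ.toMonoidHom.ker, φ.1 ⟨h, hk⟩ = 0}
  one_mem' := ⟨Subgroup.one_mem _, dual_one φ⟩
  mul_mem' := by
    rintro a b ⟨ha, ha'⟩ ⟨hb, hb'⟩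
    refine ⟨Subgroup.mul_mem _ ha hb, ?_⟩
    have := dual_mul φ ⟨a, ha⟩ ⟨b, hb⟩
    rwa [ha', hb', add_zero] at this
  inv_mem' := by
    rintro a ⟨ha, ha'⟩
    refine ⟨Subgroup.inv_mem _ ha, ?_⟩
    have := dual_inv φ ⟨a, ha⟩
    rwa [ha', neg_zero] at this

theorem dualKer_le (φ : dual A τ) : dualKer φ ≤ τ.toMonoidHom.ker := fun _ h => h.1

theorem mem_dualKer {φ : dual A τ} (k : τ.toMonoidHom.ker) :
    (k : H) ∈ dualKer φ ↔ φ.1 k = 0 :=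
  ⟨fun h => h.2, fun h => ⟨k.2, h⟩⟩

instance dualKer_normal (φ : dual A τ) : (dualKer φ).Normal :=
  ⟨fun h ⟨hk, h0⟩ g => ⟨τ.toMonoidHom.normal_ker.conj_mem h hk g, by
    rw [dual_conj φ g ⟨h, hk⟩, h0, smul_zero]⟩⟩

theorem commutator_le_dualKer (φ : dual A τ) :
    ⁅τ.toMonoidHom.ker, τ.toMonoidHom.ker⁆ ≤ dualKer φ := by
  refine Subgroup.commutator_le.2 fun x hx y hy => ?_
  let a : τ.toMonoidHom.ker := ⟨x, hx⟩
  let b : τ.toMonoidHom.ker := ⟨y, hy⟩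
  refine (mem_dualKer (a * b * a⁻¹ * b⁻¹)).2 ?_
  simp only [dual_mul, dual_inv]
  abel

theorem isClosed_ker [T1Space G] : IsClosed (τ.toMonoidHom.ker : Set H) :=
  isClosed_singleton.preimage τ.continuous_toFun

theorem isClosed_dualKer [T1Space G] (φ : dual A τ) : IsClosed (dualKer φ : Set H) := by
  have h : (dualKer φ : Set H) = Subtype.val '' (φ.1 ⁻¹' {0}) := by
    ext h
    exact ⟨fun ⟨hk, h0⟩ => ⟨⟨h, hk⟩, h0, rfl⟩, fun ⟨k, h0, hk⟩ => hk ▸ ⟨k.2, h0⟩⟩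
  rw [h]
  exact (isClosed_ker (τ := τ)).isClosedMap_subtype_val _ (isClosed_singleton.preimage φ.2.1)

theorem dualKer_ne_ker {φ : dual A τ} (h : φ ≠ 0) : dualKer φ ≠ τ.toMonoidHom.ker := by
  refine fun h' => h (Subtype.ext (funext fun k => (mem_dualKer k).1 ?_))
  rw [h']
  exact k.2

/-- An equivariant homomorphism to a simple module maps a normal subgroup to `0` or onto. -/
theorem dual_surjOn (hA : IsSimpleGModule G A) (hτ : Function.Surjective τ) (φ : dual A τ)
    {L : Subgroup H} [hL : L.Normal] (h : ¬ L ⊓ τ.toMonoidHom.ker ≤ dualKer φ) (a : A) :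
    ∃ l : τ.toMonoidHom.ker, (l : H) ∈ L ∧ φ.1 l = a := by
  let B : AddSubgroup A :=
    { carrier := {a | ∃ l : τ.toMonoidHom.ker, (l : H) ∈ L ∧ φ.1 l = a}
      zero_mem' := ⟨1, L.one_mem, dual_one φ⟩
      add_mem' := by
        rintro _ _ ⟨l, hl, rfl⟩ ⟨m, hm, rfl⟩
        exact ⟨l * m, L.mul_mem hl hm, dual_mul φ l m⟩
      neg_mem' := by
        rintro _ ⟨l, hl, rfl⟩
        exact ⟨l⁻¹, L.inv_mem hl, dual_inv φ l⟩ }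
  rcases hA.eq_bot_or_eq_top B (by
    rintro g _ ⟨l, hl, rfl⟩
    obtain ⟨x, rfl⟩ := hτ g
    exact ⟨_, hL.conj_mem l hl x, dual_conj φ x l⟩) with hB | hB
  · refine absurd (fun l hl => ?_) h
    have : φ.1 ⟨l, hl.2⟩ ∈ B := ⟨_, hl.1, rfl⟩
    rw [hB] at this
    exact ⟨hl.2, this⟩
  · exact hB.ge (AddSubgroup.mem_top a)

theorem dual_surjective (hA : IsSimpleGModule G A) (hτ : Function.Surjective τ) {φ : dual A τ}
    (h : φ ≠ 0) : Function.Surjective φ.1 := fun a => by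
  obtain ⟨l, -, hl⟩ := dual_surjOn hA hτ φ (L := ⊤)
    (fun h' => dualKer_ne_ker h (le_antisymm (dualKer_le φ) (by simpa using h'))) a
  exact ⟨l, hl⟩

/-- A normal subgroup between `dualKer φ` and the kernel of `τ` has a submodule of `A` as image. By
simplicity it is one of the two ends. -/
theorem isMaxNormalBelow_dualKer [T1Space G] (hA : IsSimpleGModule G A)
    (hτ : Function.Surjective τ) {φ : dual A τ} (h : φ ≠ 0) :
    IsMaxNormalBelow τ.toMonoidHom.ker (dualKer φ) := by
  refine ⟨⟨isClosed_dualKer φ, inferInstance, lt_of_le_of_ne (dualKer_le φ) (dualKer_ne_ker h)⟩, ?_⟩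
  rintro L ⟨-, hLn, hLK⟩ hL
  by_contra hcon
  rw [← inf_eq_left.2 hLK.le] at hcon
  refine hLK.not_ge fun k hk => ?_
  obtain ⟨l, hl, hlk⟩ := dual_surjOn hA hτ φ hcon (φ.1 ⟨k, hk⟩)
  have h1 : ((l⁻¹ * ⟨k, hk⟩ : τ.toMonoidHom.ker) : H) ∈ L :=
    hL ((mem_dualKer _).2 (by rw [dual_mul, dual_inv, hlk, neg_add_cancel]))
  simpa only [Subgroup.coe_mul, Subgroup.coe_inv, mul_inv_cancel_left] using L.mul_mem hl h1

/-- The equivariant homomorphism induced by two elements of the dual on a common domain. -/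
theorem exists_equivariant_comp_eq {B C : Type u} [AddCommGroup B] [DistribMulAction G B]
    [TopologicalSpace B] [DiscreteTopology B] [AddCommGroup C] [DistribMulAction G C]
    [TopologicalSpace C] [DiscreteTopology C] (hB : IsSimpleGModule G B)
    (hτ : Function.Surjective τ) (φ : dual B τ) (χ : dual C τ) {D : Subgroup H} [hD : D.Normal]
    (hDK : D ≤ τ.toMonoidHom.ker) (hφ : ¬ D ≤ dualKer φ) (h : D ⊓ dualKer φ ≤ dualKer χ) :
    ∃ α : B →+ C, (∀ (g : G) b, α (g • b) = g • α b) ∧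
      ∀ d : τ.toMonoidHom.ker, (d : H) ∈ D → α (φ.1 d) = χ.1 d := by
  choose l hlD hl using dual_surjOn hB hτ φ (L := D) (by rwa [inf_eq_left.2 hDK])
  -- The map `α` is `χ` evaluated at preimages under `φ` chosen in `D`. The choice is immaterial
  -- because `D ∩ Ker φ ≤ Ker χ`.
  have key : ∀ d e : τ.toMonoidHom.ker, (d : H) ∈ D → (e : H) ∈ D → φ.1 d = φ.1 e →
      χ.1 d = χ.1 e := fun d e hd he hde => by
    have h1 : ((d * e⁻¹ : τ.toMonoidHom.ker) : H) ∈ dualKer χ :=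
      h ⟨D.mul_mem hd (D.inv_mem he), (mem_dualKer _).2 (by rw [dual_mul, dual_inv, hde,
        add_neg_cancel])⟩
    rw [mem_dualKer, dual_mul, dual_inv, ← sub_eq_add_neg, sub_eq_zero] at h1
    exact h1
  refine ⟨AddMonoidHom.mk' (fun b => χ.1 (l b)) fun b c => ?_, fun g b => ?_, fun d hd => ?_⟩
  · rw [← dual_mul]
    exact key _ _ (hlD _) (D.mul_mem (hlD _) (hlD _)) (by rw [dual_mul, hl, hl, hl])
  · obtain ⟨x, rfl⟩ := hτ g
    change χ.1 (l (τ x • b)) = τ x • χ.1 (l b)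
    rw [← dual_conj]
    exact key _ _ (hlD _) (hD.conj_mem _ (hlD b) x) (by rw [dual_conj, hl, hl])
  · exact key _ _ (hlD _) hd (hl _)

end Dual

theorem nontrivial_EndG {G B : Type u} [Group G] [AddCommGroup B] [DistribMulAction G B]
    (hB : IsSimpleGModule G B) : Nontrivial (EndG G B) := by
  obtain ⟨b, hb⟩ := @exists_ne B hB.nontrivial 0
  exact ⟨1, 0, fun h => hb (DFunLike.congr_fun (congrArg Subtype.val h) b)⟩

/-! ### Independence -/

section Independence

variable {G H : Type u} [Group G] [TopologicalSpace G] [TotallyDisconnectedSpace G]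
  [Group H] [TopologicalSpace H] [IsTopologicalGroup H]
  [CompactSpace H] [TotallyDisconnectedSpace H] {τ : H →ₜ* G}
  {I : Type*} {A : I → Type u} [∀ i, AddCommGroup (A i)] [∀ i, DistribMulAction G (A i)]
  [∀ i, TopologicalSpace (A i)] [∀ i, DiscreteTopology (A i)]

/-- The family of subgroups formed by the `N j` and the kernels of the `c i s`. -/
def mixedFamily {J : Type*} {S : I → Type*} (N : J → Subgroup H)
    (c : ∀ i, S i → dual (A i) τ) : J ⊕ (Σ i, S i) → Subgroup H
  | .inl j => N j
  | .inr ⟨i, s⟩ => dualKer (c i s)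

/-- This is the analogue of the fact that a functional vanishing on finitely many kernels is a
combination of the given functionals. When a member is removed from the family, a non-abelian one is
irrelevant by `le_of_inf_le_of_nonabelian`. For an abelian one, `φ` agrees on the remaining
intersection `D` with `α ∘ c i' s`. If `i' = i`, subtract this and induct; otherwise `α = 0`. -/
theorem mem_span_of_finInf_le_dualKer {J : Type*} {S : I → Type*} (hτ : Function.Surjective τ)
    (hA : ∀ i, IsSimpleGModule G (A i))
    (hAA : ∀ i i', i ≠ i' → ∀ α : A i →+ A i', (∀ (g : G) a, α (g • a) = g • α a) → α = 0)
    (N : J → Subgroup H) (hN : ∀ j, IsMaxNormalBelow τ.toMonoidHom.ker (N j))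
    (hNna : ∀ j, ¬ ⁅τ.toMonoidHom.ker, τ.toMonoidHom.ker⁆ ≤ N j)
    (c : ∀ i, S i → dual (A i) τ) (F : Finset (J ⊕ (Σ i, S i))) (i : I) (φ : dual (A i) τ)
    (h : finInf τ.toMonoidHom.ker (mixedFamily N c) F ≤ dualKer φ) :
    φ ∈ Submodule.span (EndG G (A i)) (c i '' {s | Sum.inr ⟨i, s⟩ ∈ F}) := by
  classical
  have hcl : ∀ x, IsClosed (mixedFamily N c x : Set H) := by
    rintro (j | ⟨i, s⟩)
    · exact (hN j).1.1
    · exact isClosed_dualKer (c i s)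
  have hno : ∀ x, (mixedFamily N c x).Normal := by
    rintro (j | ⟨i, s⟩)
    · exact (hN j).1.2.1
    · exact dualKer_normal (c i s)
  induction F using Finset.induction_on generalizing φ with
  | empty =>
    have : φ = 0 := by
      by_contra hφ
      exact dualKer_ne_ker hφ (le_antisymm (dualKer_le φ)
        fun k hk => h (mem_finInf.2 ⟨hk, by simp⟩))
    rw [this]
    exact Submodule.zero_mem _
  | insert x F hx ih =>
    have hmono : Submodule.span (EndG G (A i)) (c i '' {s | Sum.inr ⟨i, s⟩ ∈ F}) ≤
        Submodule.span (EndG G (A i)) (c i '' {s | Sum.inr ⟨i, s⟩ ∈ insert x F}) :=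
      Submodule.span_mono (Set.image_mono fun s hs => Finset.mem_insert_of_mem hs)
    rw [finInf_insert] at h
    set D := finInf τ.toMonoidHom.ker (mixedFamily N c) F with hD
    have hDn : D.Normal := normal_finInf hno F
    by_cases hDφ : D ≤ dualKer φ
    · exact hmono (ih φ hDφ)
    by_cases hDx : D ≤ mixedFamily N c x
    · exact hmono (ih φ ((le_inf le_rfl hDx).trans h))
    rcases x with j | ⟨i', s⟩
    · exact absurd (le_of_inf_le_of_nonabelian (isClosed_finInf isClosed_ker hcl F) finInf_le
        (hN j) (hNna j) (isClosed_dualKer φ) (commutator_le_dualKer φ) hDx h) hDφ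
    · obtain ⟨α, hα, hαd⟩ := exists_equivariant_comp_eq (hA i') hτ (c i' s) φ finInf_le hDx h
      by_cases hi : i' = i
      · subst hi
        let α' : EndG G (A i') := ⟨α, hα⟩
        have h1 : φ - α' • c i' s ∈
            Submodule.span (EndG G (A i')) (c i' '' {s | Sum.inr ⟨i', s⟩ ∈ F}) := by
          refine ih _ fun d hd => ⟨finInf_le hd, ?_⟩
          have := hαd ⟨d, finInf_le hd⟩ hd
          change φ.1 _ - α ((c i' s).1 _) = 0
          rw [this, sub_self]
        have h2 : c i' s ∈ Submodule.span (EndG G (A i'))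
            (c i' '' {t | Sum.inr ⟨i', t⟩ ∈ insert (Sum.inr ⟨i', s⟩) F}) :=
          Submodule.subset_span ⟨s, Finset.mem_insert_self _ _, rfl⟩
        have := Submodule.add_mem _ (hmono h1) (Submodule.smul_mem _ α' h2)
        rwa [sub_add_cancel] at this
      · refine absurd (fun d hd => ⟨finInf_le hd, ?_⟩) hDφ
        rw [← hαd ⟨d, finInf_le hd⟩ hd, hAA i' i hi α hα, AddMonoidHom.zero_apply]

/-- Elements of the kernel with prescribed residues modulo distinct non-abelian maximal normal
subgroups and prescribed values under linearly independent homomorphisms exist. -/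
theorem exists_ker_of_independent {J : Type*} {S : I → Type*} (hτ : Function.Surjective τ)
    (hA : ∀ i, IsSimpleGModule G (A i))
    (hAA : ∀ i i', i ≠ i' → ∀ α : A i →+ A i', (∀ (g : G) a, α (g • a) = g • α a) → α = 0)
    (N : J → Subgroup H) (hNinj : Function.Injective N)
    (hN : ∀ j, IsMaxNormalBelow τ.toMonoidHom.ker (N j))
    (hNna : ∀ j, ¬ ⁅τ.toMonoidHom.ker, τ.toMonoidHom.ker⁆ ≤ N j)
    (c : ∀ i, S i → dual (A i) τ) (hc : ∀ i, LinearIndependent (EndG G (A i)) (c i))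
    (t : J → H) (ht : ∀ j, t j ∈ τ.toMonoidHom.ker) (a : ∀ i, S i → A i) :
    ∃ k : τ.toMonoidHom.ker, (∀ j, (t j)⁻¹ * k ∈ N j) ∧ ∀ i s, (c i s).1 k = a i s := by
  have hnt := fun i => nontrivial_EndG (hA i)
  have hmax : ∀ x, IsMaxNormalBelow τ.toMonoidHom.ker (mixedFamily N c x) := by
    rintro (j | ⟨i, s⟩)
    · exact hN j
    · exact isMaxNormalBelow_dualKer (hA i) hτ ((hc i).ne_zero s)
  choose p hp using fun i s => dual_surjective (hA i) hτ ((hc i).ne_zero s) (a i s)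
  -- At a non-abelian `N j`, containment of another member would be equality by maximality, which
  -- injectivity of `N` or non-commutativity excludes. At `c i s`, containment would put it in the
  -- span of the others.
  have hind : ∀ (F : Finset (J ⊕ (Σ i, S i))) (x), x ∉ F →
      ¬ finInf τ.toMonoidHom.ker (mixedFamily N c) F ≤ mixedFamily N c x := by
    rintro F (j | ⟨i, s⟩) hx
    · refine not_finInf_le_of_nonabelian isClosed_ker _ hmax (hN j) (hNna j) F fun y hy hle => ?_
      have heq := (hmax y).eq_of_le (hN j) hle
      rcases y with j' | ⟨i, s⟩
      · rw [hNinj heq] at hy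
        exact hx hy
      · exact hNna j ((commutator_le_dualKer (c i s)).trans heq.le)
    · intro h
      have hspan := mem_span_of_finInf_le_dualKer hτ hA hAA N hN hNna c F i (c i s) h
      have := hnt i
      refine absurd hspan ((hc i).notMem_span_image ?_)
      exact hx
  obtain ⟨k, hk, hk'⟩ := exists_mem_cosets isClosed_ker (mixedFamily N c) hmax hind
    (fun x => match x with
      | .inl j => t j
      | .inr ⟨i, s⟩ => p i s)
    (by
      rintro (j | ⟨i, s⟩)
      · exact ht j
      · exact (p i s).2)
  refine ⟨⟨k, hk⟩, fun j => hk' (.inl j), fun i s => ?_⟩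
  have h1 : (((p i s)⁻¹ * ⟨k, hk⟩ : τ.toMonoidHom.ker) : H) ∈ dualKer (c i s) := hk' (.inr ⟨i, s⟩)
  rw [mem_dualKer, dual_mul, dual_inv, hp, neg_add_eq_zero] at h1
  exact h1.symm

end Independence

/-! ### Isomorphisms over `G` -/

theorem isHomeomorph_of_bijective {X Y : Type*} [TopologicalSpace X] [TopologicalSpace Y]
    [CompactSpace X] [T2Space Y] {f : X → Y} (hf : Continuous f) (hb : Function.Bijective f) :
    IsHomeomorph f :=
  (Continuous.homeoOfEquivCompactToT2 (f := Equiv.ofBijective f hb) hf).isHomeomorph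

section IsoOver

variable {G H H' H'' : Type u} [Group G] [TopologicalSpace G] [Group H] [TopologicalSpace H]
  [Group H'] [TopologicalSpace H'] [Group H''] [TopologicalSpace H'']
  {τ : H →ₜ* G} {τ' : H' →ₜ* G} {τ'' : H'' →ₜ* G}

theorem IsoOver.refl (τ : H →ₜ* G) : IsoOver τ τ := ⟨.refl H, fun _ => rfl⟩

theorem IsoOver.symm : IsoOver τ τ' → IsoOver τ' τ
  | ⟨e, he⟩ => ⟨e.symm, fun h => by rw [← he, e.apply_symm_apply]⟩

theorem IsoOver.trans : IsoOver τ τ' → IsoOver τ' τ'' → IsoOver τ τ''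
  | ⟨e, he⟩, ⟨e', he'⟩ => ⟨e.trans e', fun h => by rw [← he, ← he']; rfl⟩

theorem IsoOver.dominates : IsoOver τ τ' → Dominates τ τ'
  | ⟨e, he⟩ => ⟨⟨e.toMulEquiv.toMonoidHom, e.continuous_toFun⟩, e.surjective, he⟩

theorem isoOver_of_bijective [CompactSpace H] [T2Space H'] (ψ : H →ₜ* H')
    (hψ : Function.Bijective ψ) (h : ∀ h, τ' (ψ h) = τ h) : IsoOver τ τ' :=
  ⟨{ MulEquiv.ofBijective ψ.toMonoidHom hψ with
      continuous_toFun := ψ.continuous_toFun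
      continuous_invFun := (Continuous.homeoOfEquivCompactToT2
        (f := Equiv.ofBijective ψ hψ) ψ.continuous_toFun).symm.continuous }, h⟩

theorem isoOver_quotMap_comap [IsTopologicalGroup H'] [CompactSpace H]
    {N' : Subgroup H'} [N'.Normal] (hc : IsClosed (N' : Set H')) (hN' : N' ≤ τ'.toMonoidHom.ker)
    (ψ : H →ₜ* H') (hψ : Function.Surjective ψ) (h : ∀ h, τ' (ψ h) = τ h)
    (hN : N'.comap ψ.toMonoidHom ≤ τ.toMonoidHom.ker) :
    IsoOver (quotMap τ (N'.comap ψ.toMonoidHom) hN) (quotMap τ' N' hN') := by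
  refine isoOver_of_bijective
    ⟨QuotientGroup.map (N'.comap ψ.toMonoidHom) N' ψ.toMonoidHom le_rfl, ?_⟩ ⟨?_, ?_⟩ ?_
  · exact Continuous.quotient_lift (QuotientGroup.continuous_mk.comp ψ.continuous_toFun) _
  · refine (injective_iff_map_eq_one _).2 fun x hx => ?_
    obtain ⟨x, rfl⟩ := QuotientGroup.mk_surjective x
    exact (QuotientGroup.eq_one_iff x).2 ((QuotientGroup.eq_one_iff (ψ x)).1 hx)
  · intro y
    obtain ⟨y, rfl⟩ := QuotientGroup.mk_surjective y
    obtain ⟨x, rfl⟩ := hψ y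
    exact ⟨x, rfl⟩
  · intro x
    obtain ⟨x, rfl⟩ := QuotientGroup.mk_surjective x
    exact h x

/-- Taking preimages under the epimorphism is injective on subgroups and preserves the quotient over
`G`. -/
theorem multNa_le_of_dominates {E : Type u} [Group E] [TopologicalSpace E]
    [IsTopologicalGroup H'] [CompactSpace H] (ζ : E →ₜ* G) (h : Dominates τ τ') :
    multNa ζ τ' ≤ multNa ζ τ := by
  obtain ⟨ψ, hψ, h⟩ := h
  refine Cardinal.mk_le_of_injective (f := fun N => ⟨N.1.comap ψ.toMonoidHom, ?_⟩) ?_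
  · obtain ⟨N, hc, hn, hN, hiso⟩ := N
    have hle : N.comap ψ.toMonoidHom ≤ τ.toMonoidHom.ker := fun x hx =>
      (h x).symm.trans (hN hx)
    exact ⟨hc.preimage ψ.continuous_toFun, inferInstance, hle,
      (isoOver_quotMap_comap hc hN ψ hψ h hle).trans hiso⟩
  · intro N₁ N₂ h12
    exact Subtype.ext (Subgroup.comap_injective (f := ψ.toMonoidHom) hψ (congrArg Subtype.val h12))

/-- The quotient map as a continuous homomorphism. -/
def mkHom (N : Subgroup H) [N.Normal] : H →ₜ* H ⧸ N :=
  ⟨QuotientGroup.mk' N, QuotientGroup.continuous_mk⟩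

theorem quotMap_mkHom (N : Subgroup H) [N.Normal] (hN : N ≤ τ.toMonoidHom.ker) (h : H) :
    quotMap τ N hN (mkHom N h) = τ h := rfl

theorem ker_mkHom (N : Subgroup H) [N.Normal] : (mkHom N).toMonoidHom.ker = N :=
  QuotientGroup.ker_mk' N

theorem mkHom_surjective (N : Subgroup H) [N.Normal] : Function.Surjective (mkHom N) :=
  QuotientGroup.mk_surjective

end IsoOver

/-! ### Functoriality of the dual -/

section Pullback

variable {G H H' : Type u} [Group G] [TopologicalSpace G] [Group H] [TopologicalSpace H]
  [Group H'] [TopologicalSpace H'] {τ : H →ₜ* G} {τ' : H' →ₜ* G}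
  (A : Type u) [AddCommGroup A] [DistribMulAction G A] [TopologicalSpace A] [DiscreteTopology A]

/-- The map of kernels induced by a homomorphism over `G`. -/
def kerMap (ψ : H →ₜ* H') (h : ∀ h, τ' (ψ h) = τ h) (k : τ.toMonoidHom.ker) :
    τ'.toMonoidHom.ker :=
  ⟨ψ k, (h k).trans k.2⟩

theorem continuous_kerMap (ψ : H →ₜ* H') (h : ∀ h, τ' (ψ h) = τ h) :
    Continuous (kerMap ψ h) :=
  Continuous.subtype_mk (ψ.continuous_toFun.comp continuous_subtype_val) _

theorem kerMap_surjective (ψ : H →ₜ* H') (hψ : Function.Surjective ψ) (h : ∀ h, τ' (ψ h) = τ h) :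
    Function.Surjective (kerMap ψ h) := fun ⟨k', hk'⟩ => by
  obtain ⟨k, rfl⟩ := hψ k'
  exact ⟨⟨k, (h k).symm.trans hk'⟩, rfl⟩

/-- The pullback of homomorphisms along an epimorphism over `G`. -/
def dualPullback (ψ : H →ₜ* H') (h : ∀ h, τ' (ψ h) = τ h) :
    dual A τ' →ₗ[EndG G A] dual A τ where
  toFun φ := ⟨φ.1 ∘ kerMap ψ h, φ.2.1.comp (continuous_kerMap ψ h), fun b c => by
      rw [Function.comp_apply, Function.comp_apply, Function.comp_apply, ← dual_mul]
      exact congrArg φ.1 (Subtype.ext (map_mul ψ _ _)), fun x b => by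
      have := dual_conj φ (ψ x) (kerMap ψ h b)
      rw [h] at this
      rw [Function.comp_apply, Function.comp_apply, ← this]
      refine congrArg φ.1 (Subtype.ext ?_)
      simp [kerMap]⟩
  map_add' _ _ := rfl
  map_smul' _ _ := rfl

theorem dualPullback_injective (ψ : H →ₜ* H') (hψ : Function.Surjective ψ)
    (h : ∀ h, τ' (ψ h) = τ h) : Function.Injective (dualPullback A ψ h) := fun φ χ hφ => by
  refine Subtype.ext (funext fun k' => ?_)
  obtain ⟨k, rfl⟩ := kerMap_surjective ψ hψ h k'
  exact congrFun (congrArg Subtype.val hφ) k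

variable {A} in
-- A homomorphism killing `Ker ψ` descends set-theoretically. Continuity descends too, since the
-- induced map of kernels is a closed surjection by compactness, hence a quotient map.
theorem exists_dualPullback_eq [CompactSpace H] [T1Space G] [T2Space H'] (ψ : H →ₜ* H')
    (hψ : Function.Surjective ψ) (h : ∀ h, τ' (ψ h) = τ h) (φ : dual A τ)
    (hφ : ψ.toMonoidHom.ker ≤ dualKer φ) : ∃ φ', dualPullback A ψ h φ' = φ := by
  have : CompactSpace τ.toMonoidHom.ker := isCompact_iff_compactSpace.1 isClosed_ker.isCompact
  have hq := ((continuous_kerMap ψ h).isClosedMap).isQuotientMap (continuous_kerMap ψ h)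
    (kerMap_surjective ψ hψ h)
  choose s hs using kerMap_surjective ψ hψ h
  have key : ∀ k l, kerMap ψ h k = kerMap ψ h l → φ.1 k = φ.1 l := fun k l hkl => by
    have h1 : ψ k = ψ l := congrArg Subtype.val hkl
    have h2 : ((k * l⁻¹ : τ.toMonoidHom.ker) : H) ∈ dualKer φ :=
      hφ (by change ψ (k * (l : H)⁻¹) = 1; rw [map_mul, map_inv, h1, mul_inv_cancel])
    rw [mem_dualKer, dual_mul, dual_inv, ← sub_eq_add_neg, sub_eq_zero] at h2
    exact h2
  have hcomp : (φ.1 ∘ s) ∘ kerMap ψ h = φ.1 := funext fun k => key _ _ (hs _)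
  refine ⟨⟨φ.1 ∘ s, hq.continuous_iff.2 (by rw [hcomp]; exact φ.2.1), fun b c => ?_,
    fun x' b => ?_⟩, Subtype.ext hcomp⟩
  · simp only [Function.comp_apply]
    rw [← dual_mul]
    refine key _ _ ?_
    rw [hs]
    refine Subtype.ext ?_
    have hb := congrArg Subtype.val (hs b)
    have hc := congrArg Subtype.val (hs c)
    change (b : H') * c = ψ (s b * s c)
    rw [map_mul]
    exact congrArg₂ (· * ·) hb.symm hc.symm
  · obtain ⟨x, rfl⟩ := hψ x'
    simp only [Function.comp_apply]
    rw [h, ← dual_conj]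
    refine key _ _ ?_
    rw [hs]
    refine Subtype.ext ?_
    have hb := congrArg Subtype.val (hs b)
    simp only [kerMap] at hb ⊢
    simp [hb]

variable {A} in
-- The factor set of the section `ψ ∘ u` is the image under `ψ` of the factor set of `u`, so the two
-- cocycles are equal, not merely cohomologous.
theorem pushClass_dualPullback [ContinuousMul G] [IsTopologicalGroup H] [IsTopologicalGroup H']
    (ψ : H →ₜ* H') (h : ∀ h, τ' (ψ h) = τ h) (u : G → H) (hu : IsContSection τ u)
    (hu' : IsContSection τ' (ψ ∘ u)) (φ : dual A τ') :
    pushClass A τ u hu (dualPullback A ψ h φ) = pushClass A τ' (ψ ∘ u) hu' φ := by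
  refine congrArg ((B2 G A).submoduleOf (Z2 G A)).mkQ
    (Subtype.ext (funext fun p => congrArg φ.1 (Subtype.ext ?_)))
  simp [kerMap, factorSet]

theorem IsContSection.comp (ψ : H →ₜ* H') (h : ∀ h, τ' (ψ h) = τ h) {u : G → H}
    (hu : IsContSection τ u) : IsContSection τ' (ψ ∘ u) :=
  ⟨ψ.continuous_toFun.comp hu.continuous, fun g => by
    rw [Function.comp_apply, h, hu.section_apply]⟩

variable {A} in
theorem pushClass_comp_dualPullback [ContinuousMul G] [IsTopologicalGroup H]
    [IsTopologicalGroup H'] (ψ : H →ₜ* H') (h : ∀ h, τ' (ψ h) = τ h) (u : G → H)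
    (hu : IsContSection τ u) :
    pushClass A τ u hu ∘ₗ dualPullback A ψ h = pushClass A τ' (ψ ∘ u) (hu.comp ψ h) :=
  LinearMap.ext fun φ => pushClass_dualPullback ψ h u hu (hu.comp ψ h) φ

end Pullback

/-! ### The invariants at a simple module in terms of the dual of the kernel -/

section Invariants

variable {G H : Type u} [Group G] [TopologicalSpace G] [Group H] [TopologicalSpace H]
  {τ : H →ₜ* G}
  {A : Type u} [AddCommGroup A] [DistribMulAction G A] [TopologicalSpace A] [DiscreteTopology A]
  [TotallyDisconnectedSpace G]

theorem isClosed_NA : IsClosed (NA A τ : Set H) := by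
  have h : IsClosed ((⨅ N : {N : Subgroup H // MemCA A τ N}, N.1 : Subgroup H) : Set H) := by
    rw [Subgroup.coe_iInf]
    exact isClosed_iInter fun N => N.2.1
  exact isClosed_ker.inter h

/-- By simplicity `φ` is onto, so it induces an isomorphism of `Ker τ / Ker φ` with `A`.
Consequently every `φ` kills `N_A`. -/
theorem memCA_dualKer [IsTopologicalGroup H] [CompactSpace H]
    (hA : IsSimpleGModule G A) (hτ : Function.Surjective τ) {φ : dual A τ}
    (hφ : φ ≠ 0) : MemCA A τ (dualKer φ) := by
  have hcl : IsClosed (dualKer φ : Set H) := isClosed_dualKer φ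
  obtain ⟨φ', hφ'⟩ := exists_dualPullback_eq (τ' := quotMap τ (dualKer φ) (dualKer_le φ))
    (mkHom (dualKer φ)) (mkHom_surjective _) (quotMap_mkHom _ _) φ (ker_mkHom _).le
  have hval : ∀ k, φ'.1 (kerMap (mkHom (dualKer φ)) (quotMap_mkHom _ (dualKer_le φ)) k) = φ.1 k :=
    fun k => congrFun (congrArg Subtype.val hφ') k
  have : CompactSpace (quotMap τ (dualKer φ) (dualKer_le φ)).toMonoidHom.ker :=
    isCompact_iff_compactSpace.1 isClosed_ker.isCompact
  refine ⟨hcl, inferInstance, dualKer_le φ, φ'.1, φ'.2, isHomeomorph_of_bijective φ'.2.1 ⟨?_, ?_⟩⟩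
  · have key : ∀ b, φ'.1 b = 0 → b = 1 := fun b hb => by
      obtain ⟨k, rfl⟩ := kerMap_surjective _ (mkHom_surjective _)
        (quotMap_mkHom _ (dualKer_le φ)) b
      rw [hval] at hb
      exact Subtype.ext ((QuotientGroup.eq_one_iff _).2 ((mem_dualKer k).2 hb))
    intro b c hbc
    exact mul_inv_eq_one.1 (key _ (by rw [dual_mul, dual_inv, hbc, add_neg_cancel]))
  · intro a
    obtain ⟨k, hk⟩ := dual_surjective hA hτ hφ a
    exact ⟨_, (hval k).trans hk⟩

end Invariants

section Invariants

variable {G H H' : Type u} [Group G] [TopologicalSpace G] [IsTopologicalGroup G]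
  [TotallyDisconnectedSpace G]
  [Group H] [TopologicalSpace H] [IsTopologicalGroup H] [CompactSpace H]
  [TotallyDisconnectedSpace H]
  [Group H'] [TopologicalSpace H'] [IsTopologicalGroup H'] [CompactSpace H']
  [TotallyDisconnectedSpace H']
  {τ : H →ₜ* G} {τ' : H' →ₜ* G}
  {A : Type u} [AddCommGroup A] [DistribMulAction G A] [TopologicalSpace A] [DiscreteTopology A]

/-- All homomorphisms to `A` kill `N_A`, so pullback along `H → H ⧸ N_A` is bijective on duals. It
removes `N_A` from the invariants and allows one section `u` of `τ` to serve all modules. -/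
theorem exists_equiv_dual_barA (hA : IsSimpleGModule G A) (hτ : Function.Surjective τ)
    (u : G → H) (hu : IsContSection τ u) :
    ∃ T : dual A (barA A τ) ≃ₗ[EndG G A] dual A τ,
      SA A τ hτ = pushClass A τ u hu ∘ₗ T.toLinearMap := by
  have hcl : IsClosed (NA A τ : Set H) := isClosed_NA
  have hcomp : ∀ h, barA A τ (mkHom (NA A τ) h) = τ h := quotMap_mkHom _ _
  refine ⟨LinearEquiv.ofBijective (dualPullback A (mkHom (NA A τ)) hcomp)
    ⟨dualPullback_injective A _ (mkHom_surjective _) _, fun φ => ?_⟩, ?_⟩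
  · refine exists_dualPullback_eq _ (mkHom_surjective _) _ φ ?_
    rw [ker_mkHom]
    by_cases hφ : φ = 0
    · rw [hφ]
      exact fun h hh => (mem_dualKer (φ := 0) ⟨h, NA_le A τ hh⟩).2 rfl
    · exact inf_le_right.trans (iInf_le (fun N : {N : Subgroup H // MemCA A τ N} => N.1)
        ⟨dualKer φ, memCA_dualKer hA hτ hφ⟩)
  · refine LinearMap.ext fun φ => ?_
    rw [SA, pushClass_eq (barA A τ) _ (mkHom (NA A τ) ∘ u) _ (hu.comp _ hcomp)]
    exact (pushClass_dualPullback _ _ _ _ _ φ).symm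

theorem multAb_eq (hA : IsSimpleGModule G A) (hτ : Function.Surjective τ)
    (u : G → H) (hu : IsContSection τ u) :
    multAb A τ hτ = Module.rank (EndG G A) (LinearMap.ker (pushClass A τ u hu)) := by
  obtain ⟨T, hT⟩ := exists_equiv_dual_barA hA hτ u hu
  rw [multAb, hT, LinearMap.ker_comp]
  exact (T.ofSubmodule' _).rank_eq

theorem suppAb_eq (hA : IsSimpleGModule G A) (hτ : Function.Surjective τ)
    (u : G → H) (hu : IsContSection τ u) :
    suppAb A τ hτ = LinearMap.range (pushClass A τ u hu) := by
  obtain ⟨T, hT⟩ := exists_equiv_dual_barA hA hτ u hu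
  rw [suppAb, hT, LinearMap.range_comp_of_range_eq_top _ T.range]

/-- For a section pushed forward along `ψ`, the map `S` of `τ'` is that of `τ` composed with the
injective pullback, so its kernel embeds. -/
theorem multAb_le_of_dominates (hA : IsSimpleGModule G A) (hτ : Function.Surjective τ)
    (hτ' : Function.Surjective τ') (h : Dominates τ τ') :
    multAb A τ' hτ' ≤ multAb A τ hτ := by
  obtain ⟨ψ, hψ, h⟩ := h
  obtain ⟨u, hu⟩ := exists_isContSection τ hτ
  rw [multAb_eq hA hτ u hu, multAb_eq hA hτ' _ (hu.comp ψ h),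
    ← pushClass_comp_dualPullback ψ h u hu, LinearMap.ker_comp]
  exact LinearMap.rank_le_of_injective
    ((dualPullback A ψ h).restrict (p := (LinearMap.ker _).comap (dualPullback A ψ h))
      (q := LinearMap.ker (pushClass A τ u hu)) fun _ hx => hx)
    fun x y hxy => Subtype.ext (dualPullback_injective A ψ hψ h (congrArg Subtype.val hxy))

theorem suppAb_le_of_dominates (hA : IsSimpleGModule G A) (hτ : Function.Surjective τ)
    (hτ' : Function.Surjective τ') (h : Dominates τ τ') :
    suppAb A τ' hτ' ≤ suppAb A τ hτ := by
  obtain ⟨ψ, hψ, h⟩ := h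
  obtain ⟨u, hu⟩ := exists_isContSection τ hτ
  rw [suppAb_eq hA hτ u hu, suppAb_eq hA hτ' _ (hu.comp ψ h), ← pushClass_comp_dualPullback ψ h u hu]
  exact LinearMap.range_comp_le_range _ _

end Invariants

/-! ### Gluing partial isomorphisms -/

section Cochain

variable {G H : Type u} [Group G] [TopologicalSpace G] [Group H] [TopologicalSpace H]
  {A : Type u} [AddCommGroup A] [DistribMulAction G A] [TopologicalSpace A] [DiscreteTopology A]
  {τ : H →ₜ* G}

theorem IsContSection.mul_inv_mem {u : G → H} (hu : IsContSection τ u) (h : H) :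
    h * (u (τ h))⁻¹ ∈ τ.toMonoidHom.ker := by
  change τ (h * (u (τ h))⁻¹) = 1
  rw [map_mul, map_inv, hu.section_apply, mul_inv_cancel]

/-- The extension of a homomorphism `φ` on the kernel to a 1-cochain on the whole group that is
determined by a section `u`: it maps `k * u g` to `φ k`. -/
def extend (φ : dual A τ) {u : G → H} (hu : IsContSection τ u) (h : H) : A :=
  φ.1 ⟨h * (u (τ h))⁻¹, hu.mul_inv_mem h⟩

theorem extend_ker_mul (φ : dual A τ) {u : G → H} (hu : IsContSection τ u)
    (k : τ.toMonoidHom.ker) (h : H) : extend φ hu (k * h) = φ.1 k + extend φ hu h := by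
  have hk : τ k = 1 := k.2
  rw [extend, extend, ← dual_mul]
  refine congrArg φ.1 (Subtype.ext ?_)
  change (k : H) * h * (u (τ (k * h)))⁻¹ = k * (h * (u (τ h))⁻¹)
  rw [map_mul, hk, one_mul, mul_assoc]

/-- Inflated to `H`, the pushed-out factor set is minus the coboundary of `extend φ hu`. The
identity comes from splitting `h₁ * h₂ * (u (τ (h₁ * h₂)))⁻¹` into the kernel part of `h₁`, the `u
(τ h₁)`-conjugate of that of `h₂`, and the factor set. -/
theorem extend_mul (φ : dual A τ) {u : G → H} (hu : IsContSection τ u) (h₁ h₂ : H) :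
    extend φ hu (h₁ * h₂) =
      extend φ hu h₁ + τ h₁ • extend φ hu h₂ + φ.1 (factorSet τ u hu (τ h₁, τ h₂)) := by
  have key := dual_conj φ (u (τ h₁)) ⟨h₂ * (u (τ h₂))⁻¹, hu.mul_inv_mem h₂⟩
  have hs : τ (u (τ h₁)) = τ h₁ := hu.section_apply _
  rw [hs] at key
  rw [extend, extend, extend, ← key, ← dual_mul, ← dual_mul]
  refine congrArg φ.1 (Subtype.ext ?_)
  simp only [factorSet, Subgroup.coe_mul, map_mul]
  group

theorem continuous_extend [IsTopologicalGroup H] (φ : dual A τ) {u : G → H}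
    (hu : IsContSection τ u) : Continuous (extend φ hu) := by
  have h1 := hu.continuous
  have h2 : Continuous τ := τ.continuous_toFun
  exact φ.2.1.comp (Continuous.subtype_mk (by fun_prop) _)

theorem exists_coboundary_of_pushClass_eq [ContinuousMul G]
    {H' : Type u} [Group H'] [TopologicalSpace H'] [IsTopologicalGroup H] [IsTopologicalGroup H']
    {τ' : H' →ₜ* G} {B : Type u} [AddCommGroup B] [DistribMulAction G B]
    [TopologicalSpace B] [DiscreteTopology B] {u : G → H} (hu : IsContSection τ u)
    {u' : G → H'} (hu' : IsContSection τ' u') {φ : dual B τ} {φ' : dual B τ'}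
    (h : pushClass B τ' u' hu' φ' = pushClass B τ u hu φ) :
    ∃ x : G → B, Continuous x ∧ ∀ g j, φ'.1 (factorSet τ' u' hu' (g, j)) -
      φ.1 (factorSet τ u hu (g, j)) = g • x j - x (g * j) + x g :=
  (Submodule.Quotient.eq _).1 h

end Cochain

/-! ### Lifting elements of the base group with prescribed local data. -/

section Lift

variable {G H : Type u} [Group G] [TopologicalSpace G]
  [TotallyDisconnectedSpace G] [Group H] [TopologicalSpace H] [IsTopologicalGroup H]
  [CompactSpace H] [TotallyDisconnectedSpace H] {τ : H →ₜ* G}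
  {I : Type*} {A : I → Type u} [∀ i, AddCommGroup (A i)] [∀ i, DistribMulAction G (A i)]
  [∀ i, TopologicalSpace (A i)] [∀ i, DiscreteTopology (A i)]

/-- The families `N` and `c` are independent. -/
structure IsIndependent {J : Type*} {S : I → Type*} (N : J → Subgroup H)
    (c : ∀ i, S i → dual (A i) τ) : Prop where
  injective : Function.Injective N
  isMax : ∀ j, IsMaxNormalBelow τ.toMonoidHom.ker (N j)
  nonabelian : ∀ j, ¬ ⁅τ.toMonoidHom.ker, τ.toMonoidHom.ker⁆ ≤ N j
  linearIndependent : ∀ i, LinearIndependent (EndG G (A i)) (c i)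

/-- Translation by `u g` turns the problem on the fibre over `g` into one on the kernel, which
`exists_ker_of_independent` solves. -/
theorem IsIndependent.exists_lift {J : Type*} {S : I → Type*} {N : J → Subgroup H}
    {c : ∀ i, S i → dual (A i) τ} (h : IsIndependent N c) (hτ : Function.Surjective τ)
    (hA : ∀ i, IsSimpleGModule G (A i))
    (hAA : ∀ i i', i ≠ i' → ∀ α : A i →+ A i', (∀ (g : G) a, α (g • a) = g • α a) → α = 0)
    {u : G → H} (hu : IsContSection τ u) (g : G) (y : J → H) (hy : ∀ j, τ (y j) = g)
    (a : ∀ i, S i → A i) :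
    ∃ h, τ h = g ∧ (∀ j, (y j)⁻¹ * h ∈ N j) ∧ ∀ i s, extend (c i s) hu h = a i s := by
  obtain ⟨k, hk, hk'⟩ := exists_ker_of_independent hτ hA hAA N h.injective h.isMax h.nonabelian c
    h.linearIndependent (fun j => y j * (u g)⁻¹) (fun j => by
      change τ (y j * (u g)⁻¹) = 1
      rw [map_mul, map_inv, hu.section_apply, hy, mul_inv_cancel])
    (fun i s => a i s - extend (c i s) hu (u g))
  refine ⟨k * u g, ?_, fun j => ?_, fun i s => ?_⟩
  · rw [map_mul, hu.section_apply, show τ k = 1 from k.2, one_mul]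
  · have := (h.isMax j).1.2.1.conj_mem _ (hk j) (u g)⁻¹
    rwa [show (u g)⁻¹ * ((y j * (u g)⁻¹)⁻¹ * k) * (u g)⁻¹⁻¹ = (y j)⁻¹ * (k * u g) by group] at this
  · rw [extend_ker_mul, hk', sub_add_cancel]

end Lift

/-! ### The graph of an epimorphism as a subgroup of the fibre product. -/

section Glue

variable {G H H' : Type u} [Group G] [TopologicalSpace G]
  [TotallyDisconnectedSpace G] [Group H] [TopologicalSpace H] [IsTopologicalGroup H]
  [CompactSpace H] [TotallyDisconnectedSpace H] [Group H'] [TopologicalSpace H']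
  [IsTopologicalGroup H'] [CompactSpace H'] [TotallyDisconnectedSpace H']
  {τ : H →ₜ* G} {τ' : H' →ₜ* G}
  {I : Type*} {A : I → Type u} [∀ i, AddCommGroup (A i)] [∀ i, DistribMulAction G (A i)]
  [∀ i, TopologicalSpace (A i)] [∀ i, DiscreteTopology (A i)]

/-- The zero set of a crossed homomorphism on a fibre product, intersected with the graphs of
isomorphisms between quotients. -/
def glueSubgroup {J : Type*} {S : I → Type*} (τ : H →ₜ* G) (τ' : H' →ₜ* G)
    (N : J → Subgroup H) (N' : J → Subgroup H')
    [∀ j, (N j).Normal] [∀ j, (N' j).Normal] (e : ∀ j, H ⧸ N j ≃ₜ* H' ⧸ N' j)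
    (δ : ∀ i, S i → H × H' → A i)
    (hδ : ∀ i s (p q : H × H'), τ p.1 = τ' p.2 → τ q.1 = τ' q.2 →
      δ i s (p * q) = δ i s p + τ p.1 • δ i s q) : Subgroup (H × H') where
  carrier := {p | τ p.1 = τ' p.2 ∧ (∀ j, e j (p.1 : H ⧸ N j) = (p.2 : H' ⧸ N' j)) ∧
    ∀ i s, δ i s p = 0}
  one_mem' := ⟨by simp, fun j => map_one (e j), fun i s => by
    have := hδ i s 1 1 (by simp) (by simp)
    simpa using this⟩
  mul_mem' := fun {p q} ⟨hp, hp1, hp2⟩ ⟨hq, hq1, hq2⟩ => ⟨by simp [hp, hq], fun j => by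
    simp [hp1, hq1], fun i s => by rw [hδ i s p q hp hq, hp2, hq2, smul_zero, add_zero]⟩
  inv_mem' := fun {p} ⟨hp, hp1, hp2⟩ => ⟨by simp [hp], fun j => by simp [hp1], fun i s => by
    have h1 := hδ i s 1 1 (by simp) (by simp)
    have h2 := hδ i s p p⁻¹ hp (by simp [hp])
    simp only [mul_one, Prod.fst_one, map_one, one_smul, left_eq_add] at h1
    rw [mul_inv_cancel, h1, hp2, zero_add] at h2
    exact (smul_eq_zero_iff_eq _).1 h2.symm⟩

/-- The subgroup `Γ` is to be the graph of `ψ`. Independence of the primed family makes the first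
projection onto, and independence of the other one makes the second onto. `hdet'` makes the first
injective, so it is a homeomorphism by compactness, and `ψ` is the second projection after its
inverse. -/
theorem exists_hom_of_isIndependent [IsTopologicalGroup G]
    {J : Type*} {S : I → Type*} {N : J → Subgroup H} {N' : J → Subgroup H'}
    {c : ∀ i, S i → dual (A i) τ} {c' : ∀ i, S i → dual (A i) τ'}
    (h : IsIndependent N c) (h' : IsIndependent N' c')
    (hτ : Function.Surjective τ) (hτ' : Function.Surjective τ')
    (hA : ∀ i, IsSimpleGModule G (A i))
    (hAA : ∀ i i', i ≠ i' → ∀ α : A i →+ A i', (∀ (g : G) a, α (g • a) = g • α a) → α = 0)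
    {u : G → H} (hu : IsContSection τ u) {u' : G → H'} (hu' : IsContSection τ' u')
    [∀ j, (N j).Normal] [∀ j, (N' j).Normal]
    (he : ∀ j, IsoOver (quotMap τ (N j) (h.isMax j).1.2.2.le)
      (quotMap τ' (N' j) (h'.isMax j).1.2.2.le))
    (hcc : ∀ i s, pushClass (A i) τ' u' hu' (c' i s) = pushClass (A i) τ u hu (c i s))
    (hdet' : ∀ k : τ'.toMonoidHom.ker, (∀ j, (k : H') ∈ N' j) → (∀ i s, (c' i s).1 k = 0) →
      k = 1) :
    ∃ ψ : H →ₜ* H', Function.Surjective ψ ∧ (∀ h, τ' (ψ h) = τ h) ∧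
      ((∀ k : τ.toMonoidHom.ker, (∀ j, (k : H) ∈ N j) → (∀ i s, (c i s).1 k = 0) → k = 1) →
        Function.Injective ψ) := by
  choose e he using he
  choose x hxc hx using fun i s => exists_coboundary_of_pushClass_eq hu hu' (hcc i s)
  -- The coboundary of `x i s` is the difference of the two pushed-out factor sets. Adding `x i s`
  -- cancels the defects from `extend_mul`, leaving a crossed homomorphism.
  let δ : ∀ i, S i → H × H' → A i := fun i s p =>
    extend (c' i s) hu' p.2 - extend (c i s) hu p.1 + x i s (τ p.1)
  have hδ : ∀ i s (p q : H × H'), τ p.1 = τ' p.2 → τ q.1 = τ' q.2 →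
      δ i s (p * q) = δ i s p + τ p.1 • δ i s q := fun i s p q hp hq => by
    simp only [δ, Prod.fst_mul, Prod.snd_mul, extend_mul, ← hp, ← hq, smul_add, smul_sub, map_mul]
    rw [eq_add_of_sub_eq' (hx i s (τ p.1) (τ q.1))]
    abel
  let Γ := glueSubgroup τ τ' N N' e δ hδ
  have hcl : ∀ j, IsClosed (N' j : Set H') := fun j => (h'.isMax j).1.1
  have hΓ : IsClosed (Γ : Set (H × H')) := by
    have hτc : Continuous τ := τ.continuous_toFun
    have hτc' : Continuous τ' := τ'.continuous_toFun
    refine IsClosed.inter (isClosed_eq (hτc.comp continuous_fst) (hτc'.comp continuous_snd))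
      (IsClosed.inter ?_ ?_)
    · have heq : {p : H × H' | ∀ j, e j (p.1 : H ⧸ N j) = (p.2 : H' ⧸ N' j)} =
        ⋂ j, {p : H × H' | e j (p.1 : H ⧸ N j) = (p.2 : H' ⧸ N' j)} := Set.ofPred_forall _
      change IsClosed {p : H × H' | ∀ j, e j (p.1 : H ⧸ N j) = (p.2 : H' ⧸ N' j)}
      rw [heq]
      refine isClosed_iInter fun j => isClosed_eq ?_ ?_
      · exact (e j).continuous_toFun.comp (QuotientGroup.continuous_mk.comp continuous_fst)
      · exact QuotientGroup.continuous_mk.comp continuous_snd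
    · change IsClosed {p : H × H' | ∀ i s, δ i s p = 0}
      simp only [Set.ofPred_forall]
      refine isClosed_iInter fun i => isClosed_iInter fun s => isClosed_eq ?_ continuous_const
      have h1 := ((continuous_extend (c' i s) hu').comp (continuous_snd (X := H)))
      have h2 := ((continuous_extend (c i s) hu).comp (continuous_fst (Y := H')))
      have h3 := ((hxc i s).comp hτc).comp (continuous_fst (Y := H'))
      exact (continuous_of_discreteTopology (f := fun q : (A i × A i) × A i =>
        q.1.1 - q.1.2 + q.2)).comp ((h1.prodMk h2).prodMk h3)
  have : CompactSpace Γ := isCompact_iff_compactSpace.1 hΓ.isCompact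
  have hfst : ∀ a, ∃ b, (a, b) ∈ Γ := fun a => by
    choose y hy using fun j => QuotientGroup.mk_surjective (e j (a : H ⧸ N j))
    have hy' : ∀ j, τ' (y j) = τ a := fun j => by
      have := he j (a : H ⧸ N j)
      rw [← hy] at this
      exact this
    obtain ⟨b, hb, hb1, hb2⟩ := h'.exists_lift hτ' hA hAA hu' (τ a) y hy'
      fun i s => extend (c i s) hu a - x i s (τ a)
    refine ⟨b, hb.symm, fun j => ?_, fun i s => ?_⟩
    · rw [← hy]
      exact QuotientGroup.eq.2 (hb1 j)
    · simp only [δ, hb2]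
      abel
  have hsnd : ∀ b, ∃ a, (a, b) ∈ Γ := fun b => by
    choose y hy using fun j => QuotientGroup.mk_surjective ((e j).symm (b : H' ⧸ N' j))
    have hy' : ∀ j, τ (y j) = τ' b := fun j => by
      have := he j (y j : H ⧸ N j)
      rw [hy, ContinuousMulEquiv.apply_symm_apply, ← hy] at this
      exact this.symm
    obtain ⟨a, ha, ha1, ha2⟩ := h.exists_lift hτ hA hAA hu (τ' b) y hy'
      fun i s => extend (c' i s) hu' b + x i s (τ' b)
    refine ⟨a, ha, fun j => ?_, fun i s => ?_⟩
    · rw [← ContinuousMulEquiv.eq_symm_apply, ← hy]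
      exact (QuotientGroup.eq.2 (ha1 j)).symm
    · simp only [δ, ha2, ha]
      abel
  -- The sections need not be normalized, so `extend` and `x` may be nonzero at `1`; comparison with
  -- this value removes those constants.
  have hδ1 : ∀ i s, δ i s (1, 1) = 0 := Γ.one_mem.2.2
  let p₁ : Γ →ₜ* H := (ContinuousMonoidHom.fst H H').comp ⟨Γ.subtype, continuous_subtype_val⟩
  let p₂ : Γ →ₜ* H' := (ContinuousMonoidHom.snd H H').comp ⟨Γ.subtype, continuous_subtype_val⟩
  have hp₁ : Function.Bijective p₁ := by
    refine ⟨(injective_iff_map_eq_one p₁).2 ?_, fun a => ?_⟩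
    · rintro ⟨⟨a, b⟩, hb0, hb1, hb2⟩ (rfl : a = 1)
      have hb : b ∈ τ'.toMonoidHom.ker := by
        have : (1 : G) = τ' b := by simpa using hb0
        exact this.symm
      refine Subtype.ext (Prod.ext rfl (congrArg Subtype.val (hdet' ⟨b, hb⟩ (fun j => ?_)
        fun i s => ?_)))
      · have := hb1 j
        rw [QuotientGroup.mk_one, map_one] at this
        exact (QuotientGroup.eq_one_iff b).1 this.symm
      · have h1 := extend_ker_mul (c' i s) hu' ⟨b, hb⟩ 1
        have h2 := hb2 i s
        have h3 := hδ1 i s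
        simp only [δ, mul_one] at h1 h2 h3
        rw [h1, ← h3, add_left_inj, sub_left_inj, add_eq_right] at h2
        exact h2
    · obtain ⟨b, hb⟩ := hfst a
      exact ⟨⟨_, hb⟩, rfl⟩
  let E₁ : Γ ≃* H := MulEquiv.ofBijective p₁.toMonoidHom hp₁
  have hE₁ : Continuous E₁.symm :=
    (Continuous.homeoOfEquivCompactToT2 (f := Equiv.ofBijective p₁ hp₁)
      p₁.continuous_toFun).symm.continuous
  let ψ : H →ₜ* H' := p₂.comp ⟨E₁.symm.toMonoidHom, hE₁⟩
  have hψ : ∀ a b, (a, b) ∈ Γ → ψ a = b := fun a b hab => by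
    have : E₁.symm a = ⟨(a, b), hab⟩ := E₁.symm_apply_eq.2 rfl
    change p₂ (E₁.symm a) = b
    rw [this]
    rfl
  refine ⟨ψ, fun b => ?_, fun a => ?_, fun hdet => (injective_iff_map_eq_one ψ).2 fun a ha => ?_⟩
  · obtain ⟨a, ha⟩ := hsnd b
    exact ⟨a, hψ a b ha⟩
  · obtain ⟨b, hb⟩ := hfst a
    rw [hψ a b hb]
    exact hb.1.symm
  · obtain ⟨b, hb⟩ := hfst a
    obtain rfl : b = 1 := (hψ a b hb).symm.trans ha
    obtain ⟨hb0, hb1, hb2⟩ := hb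
    have hak : a ∈ τ.toMonoidHom.ker := by simpa using hb0
    refine congrArg Subtype.val (hdet ⟨a, hak⟩ (fun j => ?_) fun i s => ?_)
    · have := hb1 j
      rw [QuotientGroup.mk_one, EmbeddingLike.map_eq_one_iff] at this
      exact (QuotientGroup.eq_one_iff a).1 this
    · have h1 := extend_ker_mul (c i s) hu ⟨a, hak⟩ 1
      have h2 := hb2 i s
      have h3 := hδ1 i s
      have ha1 : τ a = 1 := hak
      simp only [δ, mul_one, ha1, map_one] at h1 h2 h3
      rw [h1, ← h3, add_left_inj, sub_right_inj, add_eq_right] at h2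
      exact h2

end Glue

/-! ### Indecomposable epimorphisms with non-abelian kernel -/

section Nonabelian

variable {G H : Type u} [Group G] [TopologicalSpace G] [Group H] [TopologicalSpace H]

/-- `N` is a maximal normal subgroup below `Ker τ` with non-abelian factor group `Ker τ / N`. -/
structure IsNonabelianMax (τ : H →ₜ* G) (N : Subgroup H) : Prop where
  isMax : IsMaxNormalBelow τ.toMonoidHom.ker N
  nonabelian : ¬ ⁅τ.toMonoidHom.ker, τ.toMonoidHom.ker⁆ ≤ N

theorem IsNonabelianMax.normal {τ : H →ₜ* G} {N : Subgroup H} (hN : IsNonabelianMax τ N) :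
    N.Normal := hN.isMax.1.2.1

theorem IsNonabelianMax.le {τ : H →ₜ* G} {N : Subgroup H} (hN : IsNonabelianMax τ N) :
    N ≤ τ.toMonoidHom.ker := hN.isMax.1.2.2.le

theorem commutator_ker_le_iff (τ : H →ₜ* G) (N : Subgroup H) [N.Normal]
    (hN : N ≤ τ.toMonoidHom.ker) : ⁅τ.toMonoidHom.ker, τ.toMonoidHom.ker⁆ ≤ N ↔
      ∀ x ∈ (quotMap τ N hN).toMonoidHom.ker, ∀ y ∈ (quotMap τ N hN).toMonoidHom.ker,
        x * y = y * x := by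
  rw [Subgroup.commutator_le]
  constructor
  · intro h x hx y hy
    obtain ⟨x, rfl⟩ := QuotientGroup.mk_surjective x
    obtain ⟨y, rfl⟩ := QuotientGroup.mk_surjective y
    exact commutatorElement_eq_one_iff_mul_comm.1 ((QuotientGroup.eq_one_iff _).2 (h x hx y hy))
  · intro h x hx y hy
    exact (QuotientGroup.eq_one_iff _).1
      (commutatorElement_eq_one_iff_mul_comm.2 (h (x : H ⧸ N) hx (y : H ⧸ N) hy))

variable [CompactSpace H]

/-- A factorization through `E` yields the closed normal subgroup `Ker (H → E)` between `N` and `Ker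
τ`. By maximality it equals one of them, and the corresponding factor is an isomorphism. -/
theorem IsNonabelianMax.isNonabelianIndecomposable [T2Space G] {τ : H →ₜ* G}
    (hτ : Function.Surjective τ) {N : Subgroup H} (hN : IsNonabelianMax τ N) [N.Normal] :
    IsNonabelianIndecomposable (quotMap τ N hN.le) where
  surjective g := by
    obtain ⟨h, rfl⟩ := hτ g
    exact ⟨h, rfl⟩
  ker_nonabelian h := hN.nonabelian ((commutator_ker_le_iff τ N hN.le).2 h)
  indecomposable := by
    refine ⟨fun h => ?_, ?_⟩
    · obtain ⟨k, hk, hkN⟩ := SetLike.exists_of_lt hN.isMax.1.2.2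
      refine hkN ((QuotientGroup.eq_one_iff k).1 (h.injective ?_))
      rw [map_one]
      exact hk
    · intro E _ _ _ _ _ ψ ρ hψ hρ h
      let f : H →ₜ* E := ψ.comp (mkHom N)
      have hf : ∀ x, ρ (f x) = τ x := fun x => h (x : H ⧸ N)
      have hfc : IsClosed (f.toMonoidHom.ker : Set H) := isClosed_ker
      have hNf : N ≤ f.toMonoidHom.ker := fun x hx => by
        change ψ (x : H ⧸ N) = 1
        rw [(QuotientGroup.eq_one_iff x).2 hx, map_one]
      have hfK : f.toMonoidHom.ker ≤ τ.toMonoidHom.ker := fun x hx => by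
        change τ x = 1
        rw [← hf, show f x = 1 from hx, map_one]
      rcases hfK.lt_or_eq with hlt | heq
      · left
        refine isHomeomorph_of_bijective ψ.continuous_toFun ⟨?_, hψ⟩
        refine (injective_iff_map_eq_one ψ).2 fun x hx => ?_
        obtain ⟨x, rfl⟩ := QuotientGroup.mk_surjective x
        exact (QuotientGroup.eq_one_iff x).2
          (hN.isMax.2 (y := f.toMonoidHom.ker) ⟨hfc, inferInstance, hlt⟩ hNf hx)
      · right
        have hinj : Function.Injective ρ := (injective_iff_map_eq_one ρ).2 fun y hy => by
          obtain ⟨x, rfl⟩ := hψ y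
          obtain ⟨x, rfl⟩ := QuotientGroup.mk_surjective x
          rw [h] at hy
          exact heq.ge hy
        exact isHomeomorph_of_bijective ρ.continuous_toFun ⟨hinj, hρ⟩

/-- Conversely, a closed normal `L` between `N` and `Ker τ` factors `ζ` through `H ⧸ L`, so
indecomposability leaves no room for a proper intermediate `L`. -/
theorem isNonabelianMax_of_isoOver [IsTopologicalGroup H]
    [T2Space G] [TotallyDisconnectedSpace H] {τ : H →ₜ* G}
    {E : Type u} [Group E] [TopologicalSpace E] [CompactSpace E] {ζ : E →ₜ* G}
    (hζ : IsNonabelianIndecomposable ζ) {N : Subgroup H} [N.Normal] (hNc : IsClosed (N : Set H))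
    (hN : N ≤ τ.toMonoidHom.ker) (hiso : IsoOver (quotMap τ N hN) ζ) : IsNonabelianMax τ N := by
  obtain ⟨e, he⟩ := hiso
  refine ⟨⟨⟨hNc, inferInstance, lt_of_le_of_ne hN fun h => ?_⟩, ?_⟩, fun h => ?_⟩
  · refine hζ.indecomposable.1 (isHomeomorph_of_bijective ζ.continuous_toFun ⟨?_, hζ.surjective⟩)
    refine (injective_iff_map_eq_one ζ).2 fun x hx => ?_
    obtain ⟨x, rfl⟩ := e.surjective x
    obtain ⟨x, rfl⟩ := QuotientGroup.mk_surjective x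
    rw [he] at hx
    rw [(QuotientGroup.eq_one_iff x).2 (h.ge hx), map_one]
  · rintro L ⟨hLc, hLn, hLK⟩ hNL
    have := totallyDisconnectedSpace_quotient L hLc
    let q : H ⧸ N →ₜ* H ⧸ L := ⟨QuotientGroup.map N L (MonoidHom.id H) hNL,
      Continuous.quotient_lift QuotientGroup.continuous_mk _⟩
    let ψ : E →ₜ* H ⧸ L := q.comp ⟨e.symm.toMulEquiv.toMonoidHom, e.symm.continuous_toFun⟩
    have hψ : ∀ x : H, ψ (e (x : H ⧸ N)) = (x : H ⧸ L) := fun x => by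
      change q (e.symm (e (x : H ⧸ N))) = _
      rw [e.symm_apply_apply]
      rfl
    rcases hζ.indecomposable.2 (H ⧸ L) ψ (quotMap τ L hLK.le)
      (fun y => by
        obtain ⟨x, rfl⟩ := QuotientGroup.mk_surjective y
        exact ⟨_, hψ x⟩)
      (fun g => by
        obtain ⟨x, rfl⟩ := hζ.surjective g
        obtain ⟨x, rfl⟩ := e.surjective x
        obtain ⟨x, rfl⟩ := QuotientGroup.mk_surjective x
        exact ⟨(x : H ⧸ L), (he x).symm⟩)
      (fun x => by
        obtain ⟨x, rfl⟩ := e.surjective x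
        obtain ⟨x, rfl⟩ := QuotientGroup.mk_surjective x
        rw [hψ, he]
        rfl) with h | h
    · intro x hx
      refine (QuotientGroup.eq_one_iff x).1 (e.injective (h.injective ?_))
      rw [hψ, map_one, map_one, (QuotientGroup.eq_one_iff x).2 hx]
    · refine absurd (fun x hx => ?_) hLK.not_ge
      refine (QuotientGroup.eq_one_iff x).1 (h.injective ?_)
      rw [map_one]
      exact hx
  · refine hζ.ker_nonabelian fun x hx y hy => ?_
    obtain ⟨x, rfl⟩ := e.surjective x
    obtain ⟨y, rfl⟩ := e.surjective y
    rw [← map_mul, ← map_mul, (commutator_ker_le_iff τ N hN).1 h x ((he x).symm.trans hx) y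
      ((he y).symm.trans hy)]

end Nonabelian

/-! ### Abelian chief factors as modules -/

section Abelian

variable {G H : Type u} [Group G] [TopologicalSpace G] [Group H] [TopologicalSpace H]

/-- The conjugation action on an abelian kernel, as an action of the quotient. -/
theorem exists_conj_hom (π : H →ₜ* G) (hπ : Function.Surjective π)
    (hab : ∀ x ∈ π.toMonoidHom.ker, ∀ y ∈ π.toMonoidHom.ker, x * y = y * x) :
    ∃ ρ : G →* MulAut π.toMonoidHom.ker, ∀ (x : H) (b : π.toMonoidHom.ker),
      ((ρ (π x) b : π.toMonoidHom.ker) : H) = x * b * x⁻¹ := by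
  let f : H →* MulAut π.toMonoidHom.ker := MulAut.conjNormal
  have hf : π.toMonoidHom.ker ≤ f.ker := fun x hx => by
    refine MulEquiv.ext fun b => Subtype.ext ?_
    change x * b * x⁻¹ = b
    rw [hab x hx b b.2, mul_inv_cancel_right]
  refine ⟨π.toMonoidHom.liftOfSurjective hπ ⟨f, hf⟩, fun x b => ?_⟩
  have : π.toMonoidHom.liftOfSurjective hπ ⟨f, hf⟩ (π x) = f x :=
    π.toMonoidHom.liftOfRightInverse_comp_apply _ _ ⟨f, hf⟩ x
  rw [this]
  rfl

/-- A bundled finite simple `G`-module. -/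
structure FinSimpleModule (G : Type u) [Group G] [TopologicalSpace G] where
  /-- The underlying type. -/
  carrier : Type u
  [addCommGroup : AddCommGroup carrier]
  [finite : Finite carrier]
  [topologicalSpace : TopologicalSpace carrier]
  [discreteTopology : DiscreteTopology carrier]
  [distribMulAction : DistribMulAction G carrier]
  [continuousSMul : ContinuousSMul G carrier]
  isSimple : IsSimpleGModule G carrier

attribute [instance] FinSimpleModule.addCommGroup FinSimpleModule.finite
  FinSimpleModule.topologicalSpace FinSimpleModule.discreteTopology
  FinSimpleModule.distribMulAction FinSimpleModule.continuousSMul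

/-- With `U` open normal and `U ∩ Ker τ ≤ N`, representatives embed `Ker τ / N` as a set into the
finite `H ⧸ U`. -/
theorem finite_ker_quotMap [IsTopologicalGroup H] [CompactSpace H] [TotallyDisconnectedSpace H]
    [T1Space G] {τ : H →ₜ* G} {N : Subgroup H} [N.Normal]
    (hN : IsMaxNormalBelow τ.toMonoidHom.ker N) :
    Finite (quotMap τ N hN.1.2.2.le).toMonoidHom.ker := by
  obtain ⟨U, hU⟩ := hN.exists_open isClosed_ker
  have hfin : Finite (H ⧸ U.toSubgroup) := U.toSubgroup.quotient_finite_of_isOpen U.isOpen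
  choose s hs using fun b : (quotMap τ N hN.1.2.2.le).toMonoidHom.ker =>
    QuotientGroup.mk_surjective b.1
  have hsK : ∀ b, s b ∈ τ.toMonoidHom.ker := fun b => by
    have : quotMap τ N hN.1.2.2.le (s b : H ⧸ N) = 1 := by
      rw [hs]
      exact b.2
    exact this
  refine Finite.of_injective (fun b => (s b : H ⧸ U.toSubgroup)) fun b c hbc => Subtype.ext ?_
  rw [← hs b, ← hs c]
  exact QuotientGroup.eq.2 (hU ⟨QuotientGroup.eq.1 hbc,
    Subgroup.mul_mem _ (Subgroup.inv_mem _ (hsK b)) (hsK c)⟩)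

/-- The module is `Ker τ / N` itself, and `φ` is the projection. As this group is abelian,
conjugation factors through `G`. Its submodules correspond to closed normal subgroups of `H` between
`N` and `Ker τ`, so maximality is simplicity. -/
theorem exists_finSimpleModule [IsTopologicalGroup H] [CompactSpace H] [TotallyDisconnectedSpace H]
    [T2Space G] {τ : H →ₜ* G} (hτ : Function.Surjective τ) {N : Subgroup H}
    (hN : IsMaxNormalBelow τ.toMonoidHom.ker N)
    (hab : ⁅τ.toMonoidHom.ker, τ.toMonoidHom.ker⁆ ≤ N) :
    ∃ (M : FinSimpleModule G) (φ : dual M.carrier τ), dualKer φ ≤ N := by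
  have hNn := hN.1.2.1
  have hNc := hN.1.1
  have hNK := hN.1.2.2.le
  let π := quotMap τ N hNK
  have hπ : Function.Surjective π := fun g => by
    obtain ⟨h, rfl⟩ := hτ g
    exact ⟨(h : H ⧸ N), rfl⟩
  have hab' := (commutator_ker_le_iff τ N hNK).1 hab
  obtain ⟨ρ, hρ⟩ := exists_conj_hom π hπ hab'
  have hfin : Finite π.toMonoidHom.ker := finite_ker_quotMap hN
  let A := Additive π.toMonoidHom.ker
  have hA : ∀ a : A, ∃ k : τ.toMonoidHom.ker,
      Additive.ofMul (kerMap (mkHom N) (quotMap_mkHom N hNK) k) = a := fun a =>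
    kerMap_surjective (mkHom N) (mkHom_surjective N) (quotMap_mkHom N hNK) a.toMul
  let _ : AddCommGroup A :=
    { (inferInstance : AddGroup A) with
      add_comm := fun a b => congrArg Additive.ofMul
        (Subtype.ext (hab' a.toMul a.toMul.2 b.toMul b.toMul.2)) }
  have : T2Space A := inferInstanceAs (T2Space π.toMonoidHom.ker)
  have : Finite A := hfin
  let _ : DistribMulAction G A :=
    { smul := fun g a => Additive.ofMul (ρ g a.toMul)
      one_smul := fun a => by
        change Additive.ofMul (ρ 1 a.toMul) = a
        rw [map_one]
        rfl
      mul_smul := fun g h a => by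
        change Additive.ofMul (ρ (g * h) a.toMul) = Additive.ofMul (ρ g (ρ h a.toMul))
        rw [map_mul]
        rfl
      smul_zero := fun g => congrArg Additive.ofMul (map_one (ρ g))
      smul_add := fun g a b => congrArg Additive.ofMul (map_mul (ρ g) a.toMul b.toMul) }
  have hsmul : ∀ (x : H ⧸ N) (a : A), (((π x • a).toMul : π.toMonoidHom.ker) : H ⧸ N) =
      x * a.toMul * x⁻¹ := fun x a => hρ x a.toMul
  have : ContinuousSMul G A := by
    refine ⟨continuous_prod_of_discrete_right.2 fun a => ?_⟩
    -- `G` carries the quotient topology from `H ⧸ N`, where the action is plain conjugation and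
    -- visibly continuous.
    have hq := (π.continuous_toFun.isClosedMap).isQuotientMap π.continuous_toFun hπ
    refine hq.continuous_iff.2 (continuous_induced_rng.2 ?_)
    have heq : (Subtype.val ∘ (fun g : G => ((g • a).toMul : π.toMonoidHom.ker)) ∘ π) =
        fun x => x * (a.toMul : H ⧸ N) * x⁻¹ := funext fun x => hsmul x a
    change Continuous (Subtype.val ∘ (fun g : G => ((g • a).toMul : π.toMonoidHom.ker)) ∘ π)
    rw [heq]
    fun_prop
  have hsimple : IsSimpleGModule G A := by
    constructor
    · obtain ⟨k, hk, hkN⟩ := SetLike.exists_of_lt hN.1.2.2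
      refine ⟨⟨Additive.ofMul ⟨(k : H ⧸ N), hk⟩, 0, fun h => hkN ?_⟩⟩
      exact (QuotientGroup.eq_one_iff k).1 (congrArg (fun a : A => (a.toMul : H ⧸ N)) h)
    · intro B hB
      let f : τ.toMonoidHom.ker → A := fun k =>
        Additive.ofMul (kerMap (mkHom N) (quotMap_mkHom N hNK) k)
      have hfc : Continuous f := continuous_kerMap (mkHom N) (quotMap_mkHom N hNK)
      have hfx : ∀ (x : H) (k : τ.toMonoidHom.ker),
          f ⟨x * k * x⁻¹, τ.toMonoidHom.normal_ker.conj_mem k k.2 x⟩ = τ x • f k := fun x k =>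
        congrArg Additive.ofMul (Subtype.ext (hsmul (x : H ⧸ N) (f k)).symm)
      let L : Subgroup H :=
        { carrier := {h | ∃ hk : h ∈ τ.toMonoidHom.ker, f ⟨h, hk⟩ ∈ B}
          one_mem' := ⟨Subgroup.one_mem _, B.zero_mem⟩
          mul_mem' := fun ⟨ha, ha'⟩ ⟨hb, hb'⟩ => ⟨Subgroup.mul_mem _ ha hb, B.add_mem ha' hb'⟩
          inv_mem' := fun ⟨ha, ha'⟩ => ⟨Subgroup.inv_mem _ ha, B.neg_mem ha'⟩ }
      have hLc : IsClosed (L : Set H) := by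
        have heq : (L : Set H) = Subtype.val '' (f ⁻¹' B) := by
          ext h
          exact ⟨fun ⟨hk, h0⟩ => ⟨⟨h, hk⟩, h0, rfl⟩, fun ⟨k, h0, hk⟩ => hk ▸ ⟨k.2, h0⟩⟩
        rw [heq]
        exact (isClosed_ker (τ := τ)).isClosedMap_subtype_val _ ((isClosed_discrete _).preimage hfc)
      have hLn : L.Normal := ⟨fun h ⟨hk, h0⟩ x => ⟨τ.toMonoidHom.normal_ker.conj_mem h hk x, by
        rw [hfx x ⟨h, hk⟩]
        exact hB _ _ h0⟩⟩
      have hLK : L ≤ τ.toMonoidHom.ker := fun h hh => hh.1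
      have hf0 : ∀ k : τ.toMonoidHom.ker, f k = 0 ↔ (k : H) ∈ N := fun k => by
        rw [← QuotientGroup.eq_one_iff]
        exact ⟨fun h => congrArg (fun a : A => (a.toMul : H ⧸ N)) h,
          fun h => congrArg Additive.ofMul (Subtype.ext h)⟩
      rcases hLK.lt_or_eq with hlt | heq
      · left
        refine (AddSubgroup.eq_bot_iff_forall _).2 fun a ha => ?_
        obtain ⟨k, rfl⟩ := hA a
        refine (hf0 k).2 (hN.2 ⟨hLc, hLn, hlt⟩ (fun n hn => ⟨hNK hn, ?_⟩) ⟨k.2, ha⟩)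
        rw [(hf0 ⟨n, hNK hn⟩).2 hn]
        exact B.zero_mem
      · right
        refine (AddSubgroup.eq_top_iff' _).2 fun a => ?_
        obtain ⟨k, rfl⟩ := hA a
        exact (heq.ge k.2).2
  let φ₀ : dual A π := ⟨fun b => Additive.ofMul b, continuous_id, fun _ _ => rfl, fun x b =>
    congrArg Additive.ofMul (Subtype.ext (hsmul x (Additive.ofMul b)).symm)⟩
  refine ⟨⟨A, hsimple⟩, dualPullback A (mkHom N) (quotMap_mkHom N hNK) φ₀, ?_⟩
  rintro k ⟨hk, hk0⟩
  exact (QuotientGroup.eq_one_iff k).1 (congrArg (fun a : A => (a.toMul : H ⧸ N)) hk0)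

end Abelian

/-! ### Matching the invariants -/

/-! ### Comparing two linear maps with a common target. -/

section LinearAlgebra

variable {F V V' W : Type*} [DivisionRing F] [AddCommGroup V] [Module F V] [AddCommGroup V']
  [Module F V'] [AddCommGroup W] [Module F W]

/-- A linear map over `W` between the total spaces of two linear maps to `W`, extending a given
map of their kernels. -/
theorem exists_linearMap_over (S : V →ₗ[F] W) (S' : V' →ₗ[F] W)
    (ι : LinearMap.ker S' →ₗ[F] LinearMap.ker S) (hr : LinearMap.range S' ≤ LinearMap.range S) :
    ∃ Θ : V' →ₗ[F] V, S ∘ₗ Θ = S' ∧ ∀ v : LinearMap.ker S', Θ v = ι v := by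
  obtain ⟨p, hp⟩ := (LinearMap.ker S').subtype.exists_leftInverse_of_injective
    (LinearMap.ker S').ker_subtype
  obtain ⟨σ, hσ⟩ := S.rangeRestrict.exists_rightInverse_of_surjective S.range_rangeRestrict
  have hσ' : ∀ w, S (σ w) = w := fun w => congrArg Subtype.val (LinearMap.congr_fun hσ w)
  -- With `p` a retraction onto `Ker S'` and `σ` a section of `S` over its image, the map is `Θ = ι
  -- ∘ p + σ ∘ S'`.
  refine ⟨(LinearMap.ker S).subtype ∘ₗ ι ∘ₗ p +
    σ ∘ₗ Submodule.inclusion hr ∘ₗ S'.rangeRestrict, LinearMap.ext fun v => ?_, fun v => ?_⟩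
  · have h1 : S (ι (p v)) = 0 := (ι (p v)).2
    simp only [LinearMap.comp_apply, LinearMap.add_apply, map_add, Submodule.subtype_apply, h1,
      hσ', zero_add]
    rfl
  · have h1 : p v = v := LinearMap.congr_fun hp v
    have h2 : S'.rangeRestrict v = 0 := Subtype.ext v.2
    simp [h1, h2]

/-- A vector killed by `Θ` is killed by `S' = S ∘ Θ`, hence lies where `Θ` is the injective `ι`. -/
theorem injective_of_over {S : V →ₗ[F] W} {S' : V' →ₗ[F] W} {Θ : V' →ₗ[F] V}
    (hΘ : S ∘ₗ Θ = S') {ι : LinearMap.ker S' →ₗ[F] LinearMap.ker S} (hι : Function.Injective ι)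
    (h : ∀ v : LinearMap.ker S', Θ v = ι v) : Function.Injective Θ := by
  refine (injective_iff_map_eq_zero Θ).2 fun v hv => ?_
  have hk : v ∈ LinearMap.ker S' := by
    rw [LinearMap.mem_ker, ← hΘ, LinearMap.comp_apply, hv, map_zero]
  have h1 := h ⟨v, hk⟩
  rw [hv] at h1
  exact congrArg Subtype.val ((injective_iff_map_eq_zero ι).1 hι ⟨v, hk⟩ (Subtype.ext h1.symm))

theorem surjective_of_over {S : V →ₗ[F] W} {S' : V' →ₗ[F] W} {Θ : V' →ₗ[F] V}
    (hΘ : S ∘ₗ Θ = S') {ι : LinearMap.ker S' →ₗ[F] LinearMap.ker S} (hι : Function.Surjective ι)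
    (h : ∀ v : LinearMap.ker S', Θ v = ι v) (hr : LinearMap.range S ≤ LinearMap.range S') :
    Function.Surjective Θ := fun w => by
  obtain ⟨v, hv⟩ := hr ⟨w, rfl⟩
  have hk : w - Θ v ∈ LinearMap.ker S := by
    rw [LinearMap.mem_ker, map_sub, ← hv, ← hΘ, LinearMap.comp_apply, sub_self]
  obtain ⟨k, hk⟩ := hι ⟨_, hk⟩
  refine ⟨k + v, ?_⟩
  rw [map_add, h, hk, sub_add_cancel]

/-- In infinite dimension an injection between spaces of equal rank need not be onto. The case of
equality is therefore treated first, with an isomorphism as witness. -/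
theorem exists_injective_of_rank_le {F : Type*} {V V' : Type u} [DivisionRing F] [AddCommGroup V]
    [Module F V] [AddCommGroup V'] [Module F V'] (h : Module.rank F V' ≤ Module.rank F V) :
    ∃ ι : V' →ₗ[F] V, Function.Injective ι ∧
      (Module.rank F V' = Module.rank F V → Function.Surjective ι) := by
  by_cases heq : Module.rank F V' = Module.rank F V
  · obtain ⟨e⟩ := nonempty_linearEquiv_of_rank_eq heq
    exact ⟨e.toLinearMap, e.injective, fun _ => e.surjective⟩
  · obtain ⟨ι, hι⟩ := rank_le_iff_exists_linearMap.1 h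
    exact ⟨ι, hι, fun h => absurd h heq⟩

/-- Here `c'` is a basis of `V'`, and `c` is its image under an injective `Θ` over `W`. Equal
kernels' ranks and equal images make `Θ` onto, so `c` spans. -/
theorem exists_matching_bases_over {F W : Type*} {V V' : Type u} [DivisionRing F]
    [AddCommGroup V] [Module F V] [AddCommGroup V'] [Module F V'] [AddCommGroup W] [Module F W]
    (S : V →ₗ[F] W) (S' : V' →ₗ[F] W)
    (hk : Module.rank F (LinearMap.ker S') ≤ Module.rank F (LinearMap.ker S))
    (hr : LinearMap.range S' ≤ LinearMap.range S) :
    ∃ (T : Type u) (c : T → V) (c' : T → V'), LinearIndependent F c ∧ LinearIndependent F c' ∧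
      Submodule.span F (Set.range c') = ⊤ ∧ (∀ s, S' (c' s) = S (c s)) ∧
      (Module.rank F (LinearMap.ker S') = Module.rank F (LinearMap.ker S) →
        LinearMap.range S' = LinearMap.range S → Submodule.span F (Set.range c) = ⊤) := by
  obtain ⟨ι, hι, hι'⟩ := exists_injective_of_rank_le hk
  obtain ⟨Θ, hΘ, hΘι⟩ := exists_linearMap_over S S' ι hr
  let b := Module.Basis.ofVectorSpace F V'
  refine ⟨_, Θ ∘ b, b, b.linearIndependent.map' Θ
    (LinearMap.ker_eq_bot.2 (injective_of_over hΘ hι hΘι)), b.linearIndependent, b.span_eq,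
    fun s => (LinearMap.congr_fun hΘ (b s)).symm, fun hm hs => ?_⟩
  rw [Set.range_comp, Submodule.span_image, b.span_eq, Submodule.map_top, LinearMap.range_eq_top]
  exact surjective_of_over hΘ (hι' hm) hΘι hs.ge

end LinearAlgebra

/-! ### Schur's lemma. -/

section Schur

variable {G A B : Type u} [Group G] [AddCommGroup A] [DistribMulAction G A] [AddCommGroup B]
  [DistribMulAction G B]

theorem bijective_of_equivariant (hA : IsSimpleGModule G A) (hB : IsSimpleGModule G B)
    (α : A →+ B) (hα : ∀ (g : G) a, α (g • a) = g • α a) (h : α ≠ 0) : Function.Bijective α := by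
  constructor
  · rcases hA.eq_bot_or_eq_top α.ker (fun g a ha => by
      rw [AddMonoidHom.mem_ker] at ha ⊢
      rw [hα, ha, smul_zero]) with h1 | h1
    · exact (AddMonoidHom.ker_eq_bot_iff α).1 h1
    · exact absurd (AddMonoidHom.ext fun a =>
        AddMonoidHom.mem_ker.1 (h1.ge (AddSubgroup.mem_top a))) h
  · rcases hB.eq_bot_or_eq_top α.range (by
      rintro g _ ⟨a, rfl⟩
      exact ⟨g • a, hα g a⟩) with h1 | h1
    · exact absurd (AddMonoidHom.ext fun a => AddSubgroup.mem_bot.1 (h1.le ⟨a, rfl⟩)) h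
    · exact AddMonoidHom.range_eq_top.1 h1

theorem isUnit_or_eq_zero_EndG (hA : IsSimpleGModule G A) (α : EndG G A) :
    IsUnit α ∨ α = 0 := by
  by_cases h : α = 0
  · exact .inr h
  · left
    let e : A ≃+ A := AddEquiv.ofBijective (α.1 : A →+ A) (bijective_of_equivariant hA hA α.1 α.2
      fun h' => h (Subtype.ext h'))
    have he : ∀ a, e a = α.1 a := fun _ => rfl
    let β : EndG G A := ⟨e.symm.toAddMonoidHom, fun g a => by
      change e.symm (g • a) = g • e.symm a
      rw [e.symm_apply_eq, he, α.2, ← he, e.apply_symm_apply]⟩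
    refine ⟨⟨α, β, ?_, ?_⟩, rfl⟩
    · exact Subtype.ext (AddMonoidHom.ext fun a => e.apply_symm_apply a)
    · exact Subtype.ext (AddMonoidHom.ext fun a => e.symm_apply_apply a)

end Schur

section Abelian

variable {G H H' : Type u} [Group G] [TopologicalSpace G] [IsTopologicalGroup G]
  [TotallyDisconnectedSpace G]
  [Group H] [TopologicalSpace H] [IsTopologicalGroup H] [CompactSpace H]
  [TotallyDisconnectedSpace H]
  [Group H'] [TopologicalSpace H'] [IsTopologicalGroup H'] [CompactSpace H']
  [TotallyDisconnectedSpace H']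
  {τ : H →ₜ* G} {τ' : H' →ₜ* G}
  {A : Type u} [AddCommGroup A] [DistribMulAction G A] [TopologicalSpace A] [DiscreteTopology A]

theorem exists_matching_bases (hA : IsSimpleGModule G A) (hτ : Function.Surjective τ)
    (hτ' : Function.Surjective τ') {u : G → H} (hu : IsContSection τ u) {u' : G → H'}
    (hu' : IsContSection τ' u') (hmult : multAb A τ' hτ' ≤ multAb A τ hτ)
    (hsupp : suppAb A τ' hτ' ≤ suppAb A τ hτ) :
    ∃ (S : Type u) (c : S → dual A τ) (c' : S → dual A τ'),
      LinearIndependent (EndG G A) c ∧ LinearIndependent (EndG G A) c' ∧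
      Submodule.span (EndG G A) (Set.range c') = ⊤ ∧
      (∀ s, pushClass A τ' u' hu' (c' s) = pushClass A τ u hu (c s)) ∧
      (multAb A τ' hτ' = multAb A τ hτ → suppAb A τ' hτ' = suppAb A τ hτ →
        Submodule.span (EndG G A) (Set.range c) = ⊤) := by
  have := nontrivial_EndG hA
  -- By Schur's lemma `F_A` is a division ring, which is what bases and splittings require.
  let _ : DivisionRing (EndG G A) := DivisionRing.ofIsUnitOrEqZero (isUnit_or_eq_zero_EndG hA)
  rw [multAb_eq hA hτ' u' hu', multAb_eq hA hτ u hu] at hmult ⊢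
  rw [suppAb_eq hA hτ' u' hu', suppAb_eq hA hτ u hu] at hsupp ⊢
  exact exists_matching_bases_over _ _ hmult hsupp

/-- Isomorphism of finite simple modules. -/
instance FinSimpleModule.setoid (G : Type u) [Group G] [TopologicalSpace G] :
    Setoid (FinSimpleModule G) where
  r M M' := ∃ α : M.carrier ≃+ M'.carrier, ∀ (g : G) a, α (g • a) = g • α a
  iseqv :=
    { refl := fun _ => ⟨.refl _, fun _ _ => rfl⟩
      symm := fun ⟨α, hα⟩ => ⟨α.symm, fun g a => by
        rw [α.symm_apply_eq, hα, α.apply_symm_apply]⟩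
      trans := fun ⟨α, hα⟩ ⟨β, hβ⟩ => ⟨α.trans β, fun g a => by
        rw [AddEquiv.trans_apply, AddEquiv.trans_apply, hα, hβ]⟩ }

/-- A representative of an isomorphism class of finite simple modules. -/
noncomputable abbrev simpleRep {G : Type u} [Group G] [TopologicalSpace G]
    (i : Quotient (FinSimpleModule.setoid G)) : Type u :=
  i.out.carrier

theorem simpleRep_hom_eq_zero {G : Type u} [Group G] [TopologicalSpace G]
    {i i' : Quotient (FinSimpleModule.setoid G)} (h : i ≠ i') (α : simpleRep i →+ simpleRep i')
    (hα : ∀ (g : G) a, α (g • a) = g • α a) : α = 0 := by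
  by_contra h0
  have hb := bijective_of_equivariant i.out.isSimple i'.out.isSimple α hα h0
  exact h (by
    rw [← i.out_eq, ← i'.out_eq]
    exact Quotient.sound ⟨AddEquiv.ofBijective α hb, hα⟩)

/-- A maximal normal subgroup below `Ker τ` either has non-abelian factor or contains the kernel of
a homomorphism to a simple module, which may be taken to be the chosen representative. So `k` lies
in all of them, and their intersection is trivial. -/
theorem eq_one_of_isFundamental (hτ : Function.Surjective τ) (hf : IsFundamental τ)
    (k : τ.toMonoidHom.ker) (hna : ∀ N, IsNonabelianMax τ N → (k : H) ∈ N)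
    (hab : ∀ (i : Quotient (FinSimpleModule.setoid G)) (φ : dual (simpleRep i) τ), φ.1 k = 0) :
    k = 1 := by
  have hk : (k : H) ∈ fundamentKernel τ := by
    refine ⟨k.2, Subgroup.mem_sInf.2 fun N hN => ?_⟩
    by_cases hc : ⁅τ.toMonoidHom.ker, τ.toMonoidHom.ker⁆ ≤ N
    · obtain ⟨M, φ, hφ⟩ := exists_finSimpleModule hτ hN hc
      obtain ⟨α, hα⟩ : M ≈ (⟦M⟧ : Quotient (FinSimpleModule.setoid G)).out :=
        Setoid.symm (Quotient.mk_out M)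
      refine hφ ((mem_dualKer k).2 (α.injective ?_))
      rw [map_zero]
      exact hab ⟦M⟧ ⟨α ∘ φ.1, continuous_of_discreteTopology.comp φ.2.1, fun b c => by
        rw [Function.comp_apply, dual_mul, map_add]
        rfl, fun x b => by
        rw [Function.comp_apply, dual_conj, hα]
        rfl⟩
    · exact hna N ⟨hN, hc⟩
  rw [hf] at hk
  exact Subtype.ext hk

end Abelian

/-! ### Matching the non-abelian maximal normal subgroups. -/

section Nonabelian

/-- A bundled indecomposable epimorphism onto `G` with non-abelian kernel. -/
structure NonabelianEpi (G : Type u) [Group G] [TopologicalSpace G] where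
  /-- The source of the epimorphism. -/
  carrier : Type u
  [group : Group carrier]
  [topologicalSpace : TopologicalSpace carrier]
  [isTopologicalGroup : IsTopologicalGroup carrier]
  [compactSpace : CompactSpace carrier]
  [totallyDisconnectedSpace : TotallyDisconnectedSpace carrier]
  /-- The epimorphism. -/
  map : carrier →ₜ* G
  isNonabelianIndecomposable : IsNonabelianIndecomposable map

attribute [instance] NonabelianEpi.group NonabelianEpi.topologicalSpace
  NonabelianEpi.isTopologicalGroup NonabelianEpi.compactSpace
  NonabelianEpi.totallyDisconnectedSpace

/-- Isomorphism over `G`. -/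
instance NonabelianEpi.setoid (G : Type u) [Group G] [TopologicalSpace G] :
    Setoid (NonabelianEpi G) where
  r ζ ζ' := IsoOver ζ.map ζ'.map
  iseqv := ⟨fun ζ => .refl ζ.map, .symm, .trans⟩

variable {G H H' : Type u} [Group G] [TopologicalSpace G] [T2Space G]
  [Group H] [TopologicalSpace H] [IsTopologicalGroup H] [CompactSpace H]
  [TotallyDisconnectedSpace H]
  [Group H'] [TopologicalSpace H'] [IsTopologicalGroup H'] [CompactSpace H']
  [TotallyDisconnectedSpace H']
  {τ : H →ₜ* G} {τ' : H' →ₜ* G}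

/-- The epimorphism onto `G` induced on the quotient by a non-abelian maximal normal subgroup. -/
def IsNonabelianMax.epi (hτ : Function.Surjective τ) (N : {N : Subgroup H // IsNonabelianMax τ N}) :
    NonabelianEpi G :=
  have := N.2.normal
  have := totallyDisconnectedSpace_quotient N.1 N.2.isMax.1.1
  { carrier := H ⧸ N.1
    map := quotMap τ N.1 N.2.le
    isNonabelianIndecomposable := N.2.isNonabelianIndecomposable hτ }

/-- The subgroups counted by the multiplicity at `ζ` are automatically non-abelian maximal, so they
form exactly one fibre of the map from such subgroups to isomorphism classes. -/
theorem mk_fiber_eq_multNa (hτ : Function.Surjective τ) (ζ : NonabelianEpi G) :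
    Cardinal.mk {N : {N : Subgroup H // IsNonabelianMax τ N} //
      (⟦IsNonabelianMax.epi hτ N⟧ : Quotient (NonabelianEpi.setoid G)) = ⟦ζ⟧} =
      multNa ζ.map τ :=
  Cardinal.mk_congr
    { toFun := fun N => ⟨N.1.1, N.1.2.isMax.1.1, N.1.2.normal, N.1.2.le, Quotient.exact N.2⟩
      invFun := fun N => ⟨⟨N.1, by
        obtain ⟨N, hc, hn, hN, hiso⟩ := N
        exact isNonabelianMax_of_isoOver ζ.isNonabelianIndecomposable hc hN hiso⟩, by
          obtain ⟨N, hc, hn, hN, hiso⟩ := N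
          exact Quotient.sound hiso⟩
      left_inv := fun _ => rfl
      right_inv := fun _ => rfl }

theorem exists_injective_over {X Y Z : Type*} (p : X → Z) (q : Y → Z)
    (h : ∀ z, Nonempty ({x // p x = z} ↪ {y // q y = z})) :
    ∃ j : X → Y, Function.Injective j ∧ ∀ x, q (j x) = p x := by
  let f := fun z => (h z).some
  refine ⟨fun x => (f (p x) ⟨x, rfl⟩).1, fun x y hxy => ?_, fun x => (f (p x) ⟨x, rfl⟩).2⟩
  have key : ∀ z (x' : {x // p x = z}), (f (p x') ⟨x', rfl⟩).1 = (f z x').1 := by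
    rintro _ ⟨x', rfl⟩
    rfl
  have hp : p y = p x := by
    rw [← (f (p x) ⟨x, rfl⟩).2, ← (f (p y) ⟨y, rfl⟩).2]
    exact congrArg q hxy.symm
  have h1 := hxy.trans (key (p x) ⟨y, hp⟩)
  exact congrArg Subtype.val ((f (p x)).injective (Subtype.ext h1))

theorem exists_bijective_over {X Y Z : Type*} (p : X → Z) (q : Y → Z)
    (h : ∀ z, Nonempty ({x // p x = z} ≃ {y // q y = z})) :
    ∃ j : X → Y, Function.Bijective j ∧ ∀ x, q (j x) = p x := by
  let f := fun z => (h z).some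
  let e : X ≃ Y := (Equiv.sigmaFiberEquiv p).symm.trans
    ((Equiv.sigmaCongrRight f).trans (Equiv.sigmaFiberEquiv q))
  exact ⟨e, e.bijective, fun x => (f (p x) ⟨x, rfl⟩).2⟩

/-- The non-abelian maximal normal subgroups of two epimorphisms can be matched. -/
theorem exists_matching_nonabelian (hτ : Function.Surjective τ) (hτ' : Function.Surjective τ')
    (h : ∀ ζ : NonabelianEpi G, multNa ζ.map τ' ≤ multNa ζ.map τ) :
    ∃ j : {N : Subgroup H' // IsNonabelianMax τ' N} → {N : Subgroup H // IsNonabelianMax τ N},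
      Function.Injective j ∧
      (∀ N, IsoOver (IsNonabelianMax.epi hτ (j N)).map (IsNonabelianMax.epi hτ' N).map) ∧
      ((∀ ζ : NonabelianEpi G, multNa ζ.map τ' = multNa ζ.map τ) → Function.Surjective j) := by
  let p := fun N => (⟦IsNonabelianMax.epi hτ' N⟧ : Quotient (NonabelianEpi.setoid G))
  let q := fun N => (⟦IsNonabelianMax.epi hτ N⟧ : Quotient (NonabelianEpi.setoid G))
  -- For infinite multiplicities, injections on fibres would not give surjectivity, so equality gets
  -- its own bijective matching.
  by_cases heq : ∀ ζ : NonabelianEpi G, multNa ζ.map τ' = multNa ζ.map τ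
  · obtain ⟨j, hj, hjq⟩ := exists_bijective_over p q fun z => by
      induction z using Quotient.inductionOn with
      | h ζ => exact Cardinal.eq.1 (by
          rw [mk_fiber_eq_multNa, mk_fiber_eq_multNa, heq])
    exact ⟨j, hj.1, fun N => Quotient.exact (hjq N), fun _ => hj.2⟩
  · obtain ⟨j, hj, hjq⟩ := exists_injective_over p q fun z => by
      induction z using Quotient.inductionOn with
      | h ζ => exact (Cardinal.le_def _ _).1 (by
          rw [mk_fiber_eq_multNa, mk_fiber_eq_multNa]
          exact h ζ)
    exact ⟨j, hj, fun N => Quotient.exact (hjq N), fun h' => absurd h' heq⟩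

end Nonabelian

/-! ### The main theorem -/

section Main

theorem eq_zero_of_span_eq_top {G H : Type u} [Group G] [TopologicalSpace G] [Group H]
    [TopologicalSpace H] {τ : H →ₜ* G} {A : Type u} [AddCommGroup A] [DistribMulAction G A]
    [TopologicalSpace A] [DiscreteTopology A] {S : Type*} {c : S → dual A τ}
    (hc : Submodule.span (EndG G A) (Set.range c) = ⊤) (k : τ.toMonoidHom.ker)
    (h : ∀ s, (c s).1 k = 0) (φ : dual A τ) : φ.1 k = 0 := by
  have hφ : φ ∈ Submodule.span (EndG G A) (Set.range c) := hc.ge Submodule.mem_top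
  induction hφ using Submodule.span_induction with
  | mem x hx =>
    obtain ⟨s, rfl⟩ := hx
    exact h s
  | zero => rfl
  | add x y _ _ hx hy =>
    change x.1 k + y.1 k = 0
    rw [hx, hy, add_zero]
  | smul a x _ hx =>
    change a • x.1 k = 0
    rw [hx, smul_zero]

variable {G H H' : Type u} [Group G] [TopologicalSpace G] [IsTopologicalGroup G]
  [TotallyDisconnectedSpace G]
  [Group H] [TopologicalSpace H] [IsTopologicalGroup H] [CompactSpace H]
  [TotallyDisconnectedSpace H]
  [Group H'] [TopologicalSpace H'] [IsTopologicalGroup H'] [CompactSpace H']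
  [TotallyDisconnectedSpace H']
  {τ : H →ₜ* G} {τ' : H' →ₜ* G}

/-- Both sufficiency claims come from one `ψ`: under equality the matched families exhaust those of
`τ`, and fundamentality of `τ` makes `ψ` injective. -/
theorem exists_hom_of_invariants (hτ : Function.Surjective τ) (hf : IsFundamental τ)
    (hτ' : Function.Surjective τ') (hf' : IsFundamental τ')
    (hna : ∀ ζ : NonabelianEpi G, multNa ζ.map τ' ≤ multNa ζ.map τ)
    (hmult : ∀ M : FinSimpleModule G, multAb M.carrier τ' hτ' ≤ multAb M.carrier τ hτ)
    (hsupp : ∀ M : FinSimpleModule G, suppAb M.carrier τ' hτ' ≤ suppAb M.carrier τ hτ) :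
    ∃ ψ : H →ₜ* H', Function.Surjective ψ ∧ (∀ h, τ' (ψ h) = τ h) ∧
      ((∀ ζ : NonabelianEpi G, multNa ζ.map τ' = multNa ζ.map τ) →
        (∀ M : FinSimpleModule G, multAb M.carrier τ' hτ' = multAb M.carrier τ hτ) →
        (∀ M : FinSimpleModule G, suppAb M.carrier τ' hτ' = suppAb M.carrier τ hτ) →
        Function.Injective ψ) := by
  obtain ⟨u, hu⟩ := exists_isContSection τ hτ
  obtain ⟨u', hu'⟩ := exists_isContSection τ' hτ'
  obtain ⟨j, hj, hjiso, hjsurj⟩ := exists_matching_nonabelian hτ hτ' hna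
  -- One representative per isomorphism class is used, so that there are no nonzero equivariant maps
  -- between modules with distinct indices.
  choose S c c' hc hc' hspan' hcc hspan using
    fun i : Quotient (FinSimpleModule.setoid G) =>
      exists_matching_bases i.out.isSimple hτ hτ' hu hu' (hmult i.out) (hsupp i.out)
  have hN : ∀ N, (j N).1.Normal := fun N => (j N).2.normal
  have hN' : ∀ N : {N : Subgroup H' // IsNonabelianMax τ' N}, N.1.Normal := fun N => N.2.normal
  obtain ⟨ψ, hψ, hψτ, hψinj⟩ := exists_hom_of_isIndependent
    (A := simpleRep) (N := fun N => (j N).1)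
    (N' := fun N : {N : Subgroup H' // IsNonabelianMax τ' N} => N.1) (c := c) (c' := c')
    ⟨Subtype.val_injective.comp hj, fun N => (j N).2.isMax, fun N => (j N).2.nonabelian, hc⟩
    ⟨Subtype.val_injective, fun N => N.2.isMax, fun N => N.2.nonabelian, hc'⟩ hτ hτ'
    (fun i => i.out.isSimple) (fun i i' => simpleRep_hom_eq_zero) hu hu' hjiso hcc
    (fun k hk hk' => eq_one_of_isFundamental hτ' hf' k (fun N hN => hk ⟨N, hN⟩)
      fun i => eq_zero_of_span_eq_top (hspan' i) k (hk' i))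
  refine ⟨ψ, hψ, hψτ, fun h1 h2 h3 => hψinj fun k hk hk' =>
    eq_one_of_isFundamental hτ hf k (fun N hN => ?_)
      fun i => eq_zero_of_span_eq_top (hspan i (h2 _) (h3 _)) k (hk' i)⟩
  obtain ⟨N', hN'⟩ := hjsurj h1 ⟨N, hN⟩
  have := hk N'
  rwa [hN'] at this

end Main

end Fundament

theorem mainTheorem6 {G H H' : Type u}
    [Group G] [TopologicalSpace G] [IsTopologicalGroup G] [CompactSpace G]
    [TotallyDisconnectedSpace G]
    [Group H] [TopologicalSpace H] [IsTopologicalGroup H] [CompactSpace H]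
    [TotallyDisconnectedSpace H]
    [Group H'] [TopologicalSpace H'] [IsTopologicalGroup H'] [CompactSpace H']
    [TotallyDisconnectedSpace H']
    (τ : H →ₜ* G) (hτ : Function.Surjective τ) (hτf : Fundament.IsFundamental τ)
    (τ' : H' →ₜ* G) (hτ' : Function.Surjective τ') (hτf' : Fundament.IsFundamental τ') :
    (Fundament.Dominates τ τ' ↔
      (∀ (E : Type u) [Group E] [TopologicalSpace E] [IsTopologicalGroup E] [CompactSpace E]
        [TotallyDisconnectedSpace E] (ζ : E →ₜ* G), Fundament.IsNonabelianIndecomposable ζ →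
          Fundament.multNa ζ τ' ≤ Fundament.multNa ζ τ) ∧
      (∀ (A : Type u) [AddCommGroup A] [Finite A] [TopologicalSpace A] [DiscreteTopology A]
        [DistribMulAction G A] [ContinuousSMul G A], Fundament.IsSimpleGModule G A →
          Fundament.multAb A τ' hτ' ≤ Fundament.multAb A τ hτ) ∧
      (∀ (A : Type u) [AddCommGroup A] [Finite A] [TopologicalSpace A] [DiscreteTopology A]
        [DistribMulAction G A] [ContinuousSMul G A], Fundament.IsSimpleGModule G A →
          Fundament.suppAb A τ' hτ' ≤ Fundament.suppAb A τ hτ)) ∧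
    (Fundament.IsoOver τ' τ ↔
      (∀ (E : Type u) [Group E] [TopologicalSpace E] [IsTopologicalGroup E] [CompactSpace E]
        [TotallyDisconnectedSpace E] (ζ : E →ₜ* G), Fundament.IsNonabelianIndecomposable ζ →
          Fundament.multNa ζ τ' = Fundament.multNa ζ τ) ∧
      (∀ (A : Type u) [AddCommGroup A] [Finite A] [TopologicalSpace A] [DiscreteTopology A]
        [DistribMulAction G A] [ContinuousSMul G A], Fundament.IsSimpleGModule G A →
          Fundament.multAb A τ' hτ' = Fundament.multAb A τ hτ) ∧
      (∀ (A : Type u) [AddCommGroup A] [Finite A] [TopologicalSpace A] [DiscreteTopology A]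
        [DistribMulAction G A] [ContinuousSMul G A], Fundament.IsSimpleGModule G A →
          Fundament.suppAb A τ' hτ' = Fundament.suppAb A τ hτ)) := by
  constructor
  · constructor
    · intro h
      exact ⟨fun E _ _ _ _ _ ζ _ => Fundament.multNa_le_of_dominates ζ h,
        fun A _ _ _ _ _ _ hA => Fundament.multAb_le_of_dominates hA hτ hτ' h,
        fun A _ _ _ _ _ _ hA => Fundament.suppAb_le_of_dominates hA hτ hτ' h⟩
    · rintro ⟨hna, hmult, hsupp⟩
      obtain ⟨ψ, hψ, hψτ, -⟩ := Fundament.exists_hom_of_invariants hτ hτf hτ' hτf'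
        (fun ζ => hna _ ζ.map ζ.isNonabelianIndecomposable)
        (fun M => hmult M.carrier M.isSimple) (fun M => hsupp M.carrier M.isSimple)
      exact ⟨ψ, hψ, hψτ⟩
  · constructor
    · intro h
      -- An isomorphism over `G` gives domination both ways, so the equalities follow by
      -- antisymmetry.
      have h₁ := h.symm.dominates
      have h₂ := h.dominates
      exact ⟨fun E _ _ _ _ _ ζ _ => le_antisymm (Fundament.multNa_le_of_dominates ζ h₁)
          (Fundament.multNa_le_of_dominates ζ h₂),
        fun A _ _ _ _ _ _ hA => le_antisymm (Fundament.multAb_le_of_dominates hA hτ hτ' h₁)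
          (Fundament.multAb_le_of_dominates hA hτ' hτ h₂),
        fun A _ _ _ _ _ _ hA => le_antisymm (Fundament.suppAb_le_of_dominates hA hτ hτ' h₁)
          (Fundament.suppAb_le_of_dominates hA hτ' hτ h₂)⟩
    · rintro ⟨hna, hmult, hsupp⟩
      obtain ⟨ψ, hψ, hψτ, hinj⟩ := Fundament.exists_hom_of_invariants hτ hτf hτ' hτf'
        (fun ζ => (hna _ ζ.map ζ.isNonabelianIndecomposable).le)
        (fun M => (hmult M.carrier M.isSimple).le) (fun M => (hsupp M.carrier M.isSimple).le)
      exact (Fundament.isoOver_of_bijective ψ ⟨hinj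
        (fun ζ => hna _ ζ.map ζ.isNonabelianIndecomposable)
        (fun M => hmult M.carrier M.isSimple) (fun M => hsupp M.carrier M.isSimple), hψ⟩ hψτ).symm
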